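/- **Setting.** Let $\phi,\psi$ be holomorphic functions of $u\in\mathbb{C}\setminus(-\infty,0]$. Work on the infinite jet space with coordinates $u^a_n$ ($a\in\{0,1\}$, $n\ge0$), and write $u^0_0=v$, $u^1_0=u$, $u^0_n=\partial^nv$, $u^1_n=\partial^nu$. Indices are raised and lowered with $\eta_{ab}=\delta_{a+b,1}$, so $\mathcal O^a=\mathcal O_{1-a}$, and repeated indices are summed. Put $$\partial=\sum_{n\ge0}u^b_{n+1}\frac{\partial}{\partial u^b_n},\qquad \mathcal U=\begin{bmatrix}\mathcal U_0^0&\mathcal U_0^1\\ \mathcal U_1^0&\mathcal U_1^1\end{bmatrix}=\begin{bmatrix}v&u\\ \phi(u)&v\end{bmatrix},\qquad \Delta=\det(\partial\,\mathcal U)=(\partial v)^2-\phi'(u)(\partial u)^2,\qquad \mathcal C=(\partial\,\mathcal U)^{-1},$$ $\mathcal C^{ab}=\eta^{ac}\mathcal C_c^b$, and define vector fields $\eth_{k,a}$, $k\ge0$, by $$\sum_{k\ge0}z^k\eth_{k,a}=\sum_{n\ge0}\bigl((\partial+z\,\partial\,\mathcal U)^n\,\partial\,\mathcal U\bigr)_a^b\,\frac{\partial}{\partial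 u^b_n}.$$ Put $\partial_{0,a}=\eth_{0,a}$ (so $\partial_{0,0}=\partial$) and $\partial_{1,a}=\eth_{1,a}+\mathcal U_a^b\,\partial_{0,b}$. Let $\langle\langle\mathcal O_a\mathcal O^b\rangle\rangle_0=\mathcal U_a^b$ (so $\langle\langle\mathcal O_0\mathcal O_0\rangle\rangle_0=u$, $\langle\langle\mathcal O_0\mathcal O_1\rangle\rangle_0=v$, $\langle\langle\mathcal O_1\mathcal O_1\rangle\rangle_0=\phi(u)$), $\mathcal F_1=\frac1{24}\log\Delta+\psi(u)$, $\langle\langle\mathcal O_a\rangle\rangle_1=\partial_{0,a}\mathcal F_1=\frac1{24}\Delta^{-1}\partial_{0,a}\Delta+\partial_{0,a}\psi$, and let longer correlators be obtained by applying further $\partial_{0,c}$. For $k\ge2$ let $$\mathcal R_{2,a}=\langle\langle\mathcal O_a\mathcal O_b\mathcal O_c\rangle\rangle_0\bigl(\tfrac7{10}\langle\langle\mathcal O^b\rangle\rangle_1\langle\langle\mathcal O^c\rangle\rangle_1+\tfrac1{10}\langle\langle\mathcal O^b\mathcal O^c\rangle\rangle_1\bigr)+\tfrac{13}{240}\langle\langle\mathcal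 O_a\mathcal O_b\mathcal O_c\mathcal O^c\rangle\rangle_0\langle\langle\mathcal O^b\rangle\rangle_1-\tfrac1{240}\langle\langle\mathcal O_a\mathcal O^b\rangle\rangle_1\langle\langle\mathcal O_b\mathcal O_c\mathcal O^c\rangle\rangle_0+\tfrac1{960}\langle\langle\mathcal O_a\mathcal O_b\mathcal O^b\mathcal O_c\mathcal O^c\rangle\rangle_0,$$ $$\mathcal R_{3,a}=\langle\langle\mathcal O_a\mathcal O_b\mathcal O_c\rangle\rangle_0\bigl(\tfrac1{20}\langle\langle\mathcal O^b\rangle\rangle_1\langle\langle\mathcal O^c\mathcal O^d\mathcal O_d\rangle\rangle_0+\tfrac1{480}\langle\langle\mathcal O^b\mathcal O^c\mathcal O^d\mathcal O_d\rangle\rangle_0\bigr)+\tfrac1{1152}\langle\langle\mathcal O_a\mathcal O^b\mathcal O^c\mathcal O_c\rangle\rangle_0\langle\langle\mathcal O_b\mathcal O^d\mathcal O_d\rangle\rangle_0,$$ $$\mathcal R_{4,a}=\tfrac1{1152}\langle\langle\mathcal O_a\mathcal O^b\mathcal O^c\rangle\rangle_0\langle\langle\mathcal O_b\mathcal O_c\mathcal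 O^d\rangle\rangle_0\langle\langle\mathcal O_d\mathcal O^e\mathcal O_e\rangle\rangle_0,\qquad \mathcal R_{k,a}=0\ (k>4).$$ Let $\eth_{1,1,a,b}=\eth_{1,a}\eth_{1,b}-3\langle\langle\mathcal O_a\mathcal O_b\mathcal O^c\rangle\rangle_0\,\eth_{1,c}$ and $$\begin{aligned}\mathcal R_{1,1,a,b}&=\tfrac{13}{10}\langle\langle\mathcal O_a\mathcal O_b\mathcal O_c\mathcal O_d\rangle\rangle_0\langle\langle\mathcal O^c\rangle\rangle_1\langle\langle\mathcal O^d\rangle\rangle_1+\tfrac45\bigl(\langle\langle\mathcal O_a\mathcal O_c\rangle\rangle_1\langle\langle\mathcal O_d\rangle\rangle_1+\tfrac1{24}\langle\langle\mathcal O_a\mathcal O_c\mathcal O_d\rangle\rangle_1\bigr)\langle\langle\mathcal O_b\mathcal O^c\mathcal O^d\rangle\rangle_0\\&+\tfrac45\langle\langle\mathcal O_a\mathcal O^c\mathcal O^d\rangle\rangle_0\bigl(\langle\langle\mathcal O_b\mathcal O_c\rangle\rangle_1\langle\langle\mathcal O_d\rangle\rangle_1+\tfrac1{24}\langle\langle\mathcal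 O_b\mathcal O_c\mathcal O_d\rangle\rangle_1\bigr)-\tfrac45\langle\langle\mathcal O_a\mathcal O_b\mathcal O_c\rangle\rangle_0\bigl(\langle\langle\mathcal O^c\mathcal O_d\rangle\rangle_1\langle\langle\mathcal O^d\rangle\rangle_1+\tfrac1{24}\langle\langle\mathcal O^c\mathcal O_d\mathcal O^d\rangle\rangle_1\bigr)\\&+\tfrac1{48}\langle\langle\mathcal O_a\mathcal O_c\mathcal O_d\mathcal O^d\rangle\rangle_0\langle\langle\mathcal O^c\mathcal O_b\rangle\rangle_1+\tfrac1{48}\langle\langle\mathcal O_a\mathcal O_c\rangle\rangle_1\langle\langle\mathcal O_b\mathcal O^c\mathcal O_d\mathcal O^d\rangle\rangle_0+\tfrac{23}{240}\langle\langle\mathcal O_a\mathcal O_b\mathcal O_c\mathcal O_d\mathcal O^d\rangle\rangle_0\langle\langle\mathcal O^c\rangle\rangle_1\\&-\tfrac1{80}\langle\langle\mathcal O_a\mathcal O_b\mathcal O_c\rangle\rangle_1\langle\langle\mathcal O^c\mathcal O^d\mathcal O_d\rangle\rangle_0+\tfrac7{30}\langle\langle\mathcal O_a\mathcal O_b\mathcal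 O_c\mathcal O_d\rangle\rangle_0\langle\langle\mathcal O^c\mathcal O^d\rangle\rangle_1+\tfrac1{576}\langle\langle\mathcal O_a\mathcal O_b\mathcal O_c\mathcal O^c\mathcal O_d\mathcal O^d\rangle\rangle_0.\end{aligned}$$ Call a function *admissible* if, on $\{u\notin(-\infty,0],\ \Delta\ne0\}$, it equals $\Delta^{-m}P$ with $m\ge0$ and $P$ a polynomial in the $u^a_n$, $n>0$, whose coefficients are holomorphic in $(v,u)$, $u\notin(-\infty,0]$. A *solution* is an admissible $\mathcal F_2$ with $$\text{(TRR21)}\quad\eth_{k,a}\mathcal F_2=\mathcal R_{k,a}\ \ (k\ge2,\ a=0,1),\qquad\text{(TRR22)}\quad\eth_{1,1,a,b}\mathcal F_2=\mathcal R_{1,1,a,b}\ \ (a,b=0,1)$$ on $\{u\notin(-\infty,0],\ \Delta\ne0\}$. Finally let $$\begin{aligned}\mathcal F_{2,0}&=\tfrac1{1152}\,\partial^2\langle\langle\mathcal O_a\mathcal O_b\mathcal O_c\mathcal O_d\rangle\rangle_0\,\mathcal C^{ab}\mathcal C^{cd}-\tfrac1{1152}\,\partial^2\langle\langle\mathcal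 O_a\mathcal O_b\rangle\rangle_0\,\partial\langle\langle\mathcal O_c\mathcal O_d\mathcal O_e\mathcal O_f\rangle\rangle_0\,\mathcal C^{ac}\mathcal C^{bd}\mathcal C^{ef}\\&-\tfrac1{360}\,\partial^2\langle\langle\mathcal O_a\mathcal O_b\mathcal O_c\rangle\rangle_0\,\partial\langle\langle\mathcal O_d\mathcal O_e\mathcal O_f\rangle\rangle_0\,\mathcal C^{ad}\mathcal C^{be}\mathcal C^{cf}\\&+\tfrac1{360}\,\partial^2\langle\langle\mathcal O_a\mathcal O_b\rangle\rangle_0\,\partial\langle\langle\mathcal O_c\mathcal O_d\mathcal O_e\rangle\rangle_0\,\partial\langle\langle\mathcal O_f\mathcal O_g\mathcal O_h\rangle\rangle_0\,\mathcal C^{ac}\mathcal C^{bf}\mathcal C^{dg}\mathcal C^{eh},\end{aligned}$$ $$\begin{aligned}\mathcal F_{2,1}&=\bigl(\tfrac1{48}\,\partial\,\partial_{0,a}\partial_{0,b}\psi+\tfrac45\,\partial\,\partial_{0,a}\psi\,\partial_{0,b}\psi\bigr)\mathcal C^{ab}+\partial^2\langle\langle\mathcal O_a\mathcal O_b\rangle\rangle_0\bigl(\tfrac1{24}\cdot\tfrac65\,\partial_{0,c}\partial_{0,d}\psi-\tfrac1{10}\,\partial_{0,c}\psi\,\partial_{0,d}\psi\bigr)\mathcal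 C^{ac}\mathcal C^{bd}\\&+\tfrac1{24}\bigl(\tfrac7{10}\,\partial^2\langle\langle\mathcal O_a\mathcal O_b\mathcal O_c\rangle\rangle_0\,\partial_{0,d}\psi-\tfrac3{10}\,\partial\langle\langle\mathcal O_a\mathcal O_b\mathcal O_c\rangle\rangle_0\,\partial\,\partial_{0,d}\psi\bigr)\mathcal C^{ab}\mathcal C^{cd}\\&+\tfrac1{24}\,\partial^2\langle\langle\mathcal O_a\mathcal O_b\rangle\rangle_0\,\partial\langle\langle\mathcal O_c\mathcal O_d\mathcal O_e\rangle\rangle_0\,\partial_{0,f}\psi\,\bigl(\tfrac3{10}\,\mathcal C^{af}\mathcal C^{bc}\mathcal C^{de}-\tfrac{23}{10}\,\mathcal C^{ac}\mathcal C^{bd}\mathcal C^{ef}\bigr)+\tfrac1{240}\,(\partial u)^4\,\phi''\,\psi''\,\Delta^{-1}.\end{aligned}$$ **Theorem.** 1. On $\{u\notin(-\infty,0],\ \Delta\ne0\}$, $$\eth_{1,1,0,0}\mathcal R_{2,0}-\eth_{2,0}\mathcal R_{1,1,0,0}=\tfrac2{15}(\partial u)^3\bigl(4(\partial v)^2+(\partial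 u)^2\phi'\bigr)\bigl(\tfrac1{24}\phi'''+\phi''\psi'-2\phi'\psi''\bigr).$$ 2. The system (TRR21), (TRR22) has a solution if and only if $\tfrac1{24}\phi'''+\phi''\psi'-2\phi'\psi''=0$ on $\mathbb C\setminus(-\infty,0]$. 3. If $\tfrac1{24}\phi'''+\phi''\psi'-2\phi'\psi''=0$, then $\mathcal F_{2,0}+\mathcal F_{2,1}$ is a solution. On the small phase space $\{\partial v=1,\ \partial u=0,\ \partial^nv=\partial^nu=0 \text{ for } n>1\}$ (with $u\notin(-\infty,0]$), it vanishes and so do its derivatives $\partial_{1,0}$ and $\partial_{1,1}$, and it is the only solution with this property. -/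

import Mathlib

open Complex

noncomputable section

namespace TwoPrimary

/-- The infinite jet space. The coordinate `x (n, a)` is `u^a_n = ∂ⁿ u^a`; here
`u^0 = v` and `u^1 = u`, so that `x (0, 0) = v`, `x (0, 1) = u`, `x (1, 0) = ∂v`,
`x (1, 1) = ∂u`, and so on. -/
abbrev Jet : Type := ℕ × Fin 2 → ℂ

/-- The index change `a ↦ 1 - a`, which raises and lowers indices with respect to the
intersection form `η_{ab} = δ_{a+b,1}`: `O^a = O_{up a}`. -/
def up (a : Fin 2) : Fin 2 := Fin.rev a

/-- The partial derivative `∂F/∂u^a_n`, for `i = (n, a)`. -/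
def pd (i : ℕ × Fin 2) (F : Jet → ℂ) (x : Jet) : ℂ :=
  deriv (fun s : ℂ => F (Function.update x i s)) (x i)

/-- The vector field `∂ = ∂_{0,0} = ∑_n u^b_{n+1} ∂/∂u^b_n` of the puncture operator. On
functions that depend on finitely many coordinates the sum is finite. -/
def dtot (F : Jet → ℂ) (x : Jet) : ℂ :=
  ∑ᶠ n : ℕ, ∑ b : Fin 2, x (n + 1, b) * pd (n, b) F x

/-- The genus 0 two-point functions `⟨⟨O_a O_b⟩⟩_0` with lower indices. -/
def twoPt (φ : ℂ → ℂ) (a b : Fin 2) (x : Jet) : ℂ :=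
  !![x (0, 1), x (0, 0); x (0, 0), φ (x (0, 1))] a b

/-- The matrix `∂U`, with entries `(∂U)_a^b = ∂⟨⟨O_a O^b⟩⟩_0`. -/
def dU (φ : ℂ → ℂ) (x : Jet) : Matrix (Fin 2) (Fin 2) ℂ :=
  Matrix.of fun a b => dtot (twoPt φ a (up b)) x

/-- The determinant `Δ = det (∂U)`. -/
def Delta (φ : ℂ → ℂ) (x : Jet) : ℂ := (dU φ x).det

/-- The inverse `C` of `∂U`, with both indices raised: `C^{ab} = η^{ac} C_c^b`. -/
def prop (φ : ℂ → ℂ) (a b : Fin 2) (x : Jet) : ℂ := (dU φ x)⁻¹ (up a) b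

/-- The coefficient of `z^k` in the matrix `(∂ + z ∂U)^n ∂U`. -/
def faa (φ : ℂ → ℂ) : ℕ → ℕ → Jet → Matrix (Fin 2) (Fin 2) ℂ
  | 0, 0 => dU φ
  | 0, _ + 1 => 0
  | n + 1, 0 => fun x => Matrix.of fun a b => dtot (fun y => faa φ n 0 y a b) x
  | n + 1, k + 1 => fun x =>
      (Matrix.of fun a b => dtot (fun y => faa φ n (k + 1) y a b) x) + dU φ x * faa φ n k x

/-- The vector field `ð_{k,a}`, the coefficient of `z^k` in
`ð_a(z) = ∑_n ((∂ + z ∂U)^n ∂U)_a^b ∂/∂u^b_n`. -/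
def eth (φ : ℂ → ℂ) (k : ℕ) (a : Fin 2) (F : Jet → ℂ) (x : Jet) : ℂ :=
  ∑ᶠ n : ℕ, ∑ b : Fin 2, faa φ n k x a b * pd (n, b) F x

/-- The vector field `∂_{0,a} = ð_{0,a}`. -/
def d0 (φ : ℂ → ℂ) (a : Fin 2) (F : Jet → ℂ) : Jet → ℂ := eth φ 0 a F

/-- The vector field `∂_{1,a} = ð_{1,a} + U_a^b ∂_{0,b}`. -/
def d1 (φ : ℂ → ℂ) (a : Fin 2) (F : Jet → ℂ) (x : Jet) : ℂ :=
  eth φ 1 a F x + ∑ b, twoPt φ a (up b) x * d0 φ b F x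

/-- The genus 0 correlation function `⟨⟨O_a O_b O_{c_1} ⋯ O_{c_r}⟩⟩_0`, for
`l = [c_1, …, c_r]`. -/
def corr0 (φ : ℂ → ℂ) (a b : Fin 2) (l : List (Fin 2)) : Jet → ℂ :=
  l.foldr (d0 φ) (twoPt φ a b)

/-- The function `ψ(u)` on the jet space. -/
def psiFn (ψ : ℂ → ℂ) (x : Jet) : ℂ := ψ (x (0, 1))

/-- The genus 1 one-point function `⟨⟨O_a⟩⟩_1 = ∂_{0,a} F_1`, where
`F_1 = (1/24) log Δ + ψ(u)`. It does not depend on the branch of the logarithm, since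
`∂_{0,a} log Δ = Δ⁻¹ ∂_{0,a} Δ`. -/
def onePt1 (φ ψ : ℂ → ℂ) (a : Fin 2) (x : Jet) : ℂ :=
  1 / 24 * ((Delta φ x)⁻¹ * d0 φ a (Delta φ) x) + d0 φ a (psiFn ψ) x

/-- The genus 1 correlation function `⟨⟨O_a O_{c_1} ⋯ O_{c_r}⟩⟩_1`, for
`l = [c_1, …, c_r]`. -/
def corr1 (φ ψ : ℂ → ℂ) (a : Fin 2) (l : List (Fin 2)) : Jet → ℂ :=
  l.foldr (d0 φ) (onePt1 φ ψ a)

/-- The part of the jet space where `u ∉ (-∞, 0]` and `Δ ≠ 0`. -/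
def domain (φ : ℂ → ℂ) : Set Jet := {x | x (0, 1) ∈ slitPlane ∧ Delta φ x ≠ 0}

/-- `F` is, on the domain, holomorphic in `(v, u)` with `u ∉ (-∞, 0]`, a Laurent polynomial
in `Δ`, and polynomial in the `u^a_n` with `n > 0`: that is, `F = Δ^{-m} P`, where `P` is a
polynomial in these `u^a_n` whose coefficients are holomorphic functions of `(v, u)`. The
variable `(n, a)` of `P` stands for `u^a_{n+1}`. -/
def Admissible (φ : ℂ → ℂ) (F : Jet → ℂ) : Prop :=
  ∃ (m : ℕ) (P : MvPolynomial (ℕ × Fin 2) (ℂ × ℂ → ℂ)),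
    (∀ s, DifferentiableOn ℂ (P.coeff s) {w : ℂ × ℂ | w.2 ∈ slitPlane}) ∧
    ∀ x ∈ domain φ, F x = ((Delta φ x) ^ m)⁻¹ *
      P.eval₂ (Pi.evalRingHom (fun _ : ℂ × ℂ => ℂ) (x (0, 0), x (0, 1)))
        (fun i => x (i.1 + 1, i.2))

/-- The right hand side `R_{k,a}` of the first genus 2 recursion, for `k ≥ 2`. -/
def R (φ ψ : ℂ → ℂ) (k : ℕ) (a : Fin 2) (x : Jet) : ℂ :=
  match k with
  | 2 =>
      ∑ b, ∑ c, (corr0 φ a b [c] x *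
          (7 / 10 * corr1 φ ψ (up b) [] x * corr1 φ ψ (up c) [] x
            + 1 / 10 * corr1 φ ψ (up b) [up c] x)
        + 13 / 240 * corr0 φ a b [c, up c] x * corr1 φ ψ (up b) [] x
        - 1 / 240 * corr1 φ ψ a [up b] x * corr0 φ b c [up c] x
        + 1 / 960 * corr0 φ a b [up b, c, up c] x)
  | 3 =>
      ∑ b, ∑ c, ∑ d, (corr0 φ a b [c] x *
          (1 / 20 * corr1 φ ψ (up b) [] x * corr0 φ (up c) (up d) [d] x
            + 1 / 480 * corr0 φ (up b) (up c) [up d, d] x)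
        + 1 / 1152 * corr0 φ a (up b) [up c, c] x * corr0 φ b (up d) [d] x)
  | 4 =>
      ∑ b, ∑ c, ∑ d, ∑ e, 1 / 1152 * corr0 φ a (up b) [up c] x * corr0 φ b c [up d] x *
        corr0 φ d (up e) [e] x
  | _ => 0

/-- The second order operator
`ð_{1,1,a,b} = ð_{1,a} ð_{1,b} - 3 ⟨⟨O_a O_b O^c⟩⟩_0 ð_{1,c}`. -/
def eth11 (φ : ℂ → ℂ) (a b : Fin 2) (F : Jet → ℂ) (x : Jet) : ℂ :=
  eth φ 1 a (eth φ 1 b F) x - 3 * ∑ c, corr0 φ a b [up c] x * eth φ 1 c F x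

/-- The right hand side `R_{1,1,a,b}` of the second genus 2 recursion. -/
def R11 (φ ψ : ℂ → ℂ) (a b : Fin 2) (x : Jet) : ℂ :=
  ∑ c, ∑ d,
    (13 / 10 * corr0 φ a b [c, d] x * corr1 φ ψ (up c) [] x * corr1 φ ψ (up d) [] x
    + 4 / 5 * (corr1 φ ψ a [c] x * corr1 φ ψ d [] x + 1 / 24 * corr1 φ ψ a [c, d] x)
        * corr0 φ b (up c) [up d] x
    + 4 / 5 * corr0 φ a (up c) [up d] x
        * (corr1 φ ψ b [c] x * corr1 φ ψ d [] x + 1 / 24 * corr1 φ ψ b [c, d] x)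
    - 4 / 5 * corr0 φ a b [c] x
        * (corr1 φ ψ (up c) [d] x * corr1 φ ψ (up d) [] x
          + 1 / 24 * corr1 φ ψ (up c) [d, up d] x)
    + 1 / 48 * corr0 φ a c [d, up d] x * corr1 φ ψ (up c) [b] x
    + 1 / 48 * corr1 φ ψ a [c] x * corr0 φ b (up c) [d, up d] x
    + 23 / 240 * corr0 φ a b [c, d, up d] x * corr1 φ ψ (up c) [] x
    - 1 / 80 * corr1 φ ψ a [b, c] x * corr0 φ (up c) (up d) [d] x
    + 7 / 30 * corr0 φ a b [c, d] x * corr1 φ ψ (up c) [up d] x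
    + 1 / 576 * corr0 φ a b [c, up c, d, up d] x)

/-- `F` solves the two genus 2 topological recursion systems. -/
def Solves (φ ψ : ℂ → ℂ) (F : Jet → ℂ) : Prop :=
  (∀ k, 2 ≤ k → ∀ a, ∀ x ∈ domain φ, eth φ k a F x = R φ ψ k a x) ∧
  (∀ a b, ∀ x ∈ domain φ, eth11 φ a b F x = R11 φ ψ a b x)

/-- The function `(1/24) φ''' + φ'' ψ' - 2 φ' ψ''` of `u`. -/
def genusOne (φ ψ : ℂ → ℂ) (u : ℂ) : ℂ :=
  1 / 24 * iteratedDeriv 3 φ u + iteratedDeriv 2 φ u * deriv ψ u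
    - 2 * deriv φ u * iteratedDeriv 2 ψ u

/-- The function `∂ⁿ⟨⟨O_a O_b O_{c_1} ⋯ O_{c_r}⟩⟩_0`, for `l = [c_1, …, c_r]`. -/
def vert (φ : ℂ → ℂ) (n : ℕ) (a b : Fin 2) (l : List (Fin 2)) : Jet → ℂ :=
  dtot^[n] (corr0 φ a b l)

/-- The function `∂ⁿ ∂_{0,a_1} ⋯ ∂_{0,a_r} ψ`, for `l = [a_1, …, a_r]`. -/
def psiVert (φ ψ : ℂ → ℂ) (n : ℕ) (l : List (Fin 2)) : Jet → ℂ :=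
  dtot^[n] (l.foldr (d0 φ) (psiFn ψ))

/-- The Feynman graph expression `F_{2,0}`. -/
def F20 (φ : ℂ → ℂ) (x : Jet) : ℂ :=
  1 / 1152 * (∑ a, ∑ b, ∑ c, ∑ d,
    vert φ 2 a b [c, d] x * prop φ a b x * prop φ c d x)
  - 1 / 1152 * (∑ a, ∑ b, ∑ c, ∑ d, ∑ e, ∑ f,
    vert φ 2 a b [] x * vert φ 1 c d [e, f] x * prop φ a c x * prop φ b d x * prop φ e f x)
  - 1 / 360 * (∑ a, ∑ b, ∑ c, ∑ d, ∑ e, ∑ f,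
    vert φ 2 a b [c] x * vert φ 1 d e [f] x * prop φ a d x * prop φ b e x * prop φ c f x)
  + 1 / 360 * (∑ a, ∑ b, ∑ c, ∑ d, ∑ e, ∑ f, ∑ g, ∑ h,
    vert φ 2 a b [] x * vert φ 1 c d [e] x * vert φ 1 f g [h] x
      * prop φ a c x * prop φ b f x * prop φ d g x * prop φ e h x)

/-- The function `F_{2,1}`. Terms linear in `ψ` carry a factor `1/24`, and terms quadratic
in `ψ` the factor `1`; this goes with the normalization `F_1 = (1/24) log Δ + ψ`. -/
def F21 (φ ψ : ℂ → ℂ) (x : Jet) : ℂ :=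
  (∑ a, ∑ b,
    (1 / 24 * (1 / 2) * psiVert φ ψ 1 [a, b] x
      + 4 / 5 * psiVert φ ψ 1 [a] x * psiVert φ ψ 0 [b] x) * prop φ a b x)
  + (∑ a, ∑ b, ∑ c, ∑ d,
    vert φ 2 a b [] x
      * (1 / 24 * (6 / 5) * psiVert φ ψ 0 [c, d] x
        - 1 / 10 * psiVert φ ψ 0 [c] x * psiVert φ ψ 0 [d] x)
      * prop φ a c x * prop φ b d x)
  + 1 / 24 * (∑ a, ∑ b, ∑ c, ∑ d,
    (7 / 10 * vert φ 2 a b [c] x * psiVert φ ψ 0 [d] x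
      - 3 / 10 * vert φ 1 a b [c] x * psiVert φ ψ 1 [d] x)
      * prop φ a b x * prop φ c d x)
  + 1 / 24 * (∑ a, ∑ b, ∑ c, ∑ d, ∑ e, ∑ f,
    vert φ 2 a b [] x * vert φ 1 c d [e] x * psiVert φ ψ 0 [f] x
      * (3 / 10 * prop φ a f x * prop φ b c x * prop φ d e x
        - 23 / 10 * prop φ a c x * prop φ b d x * prop φ e f x))
  + 1 / 24 * (1 / 10 * x (1, 1) ^ 4 * iteratedDeriv 2 φ (x (0, 1))
      * iteratedDeriv 2 ψ (x (0, 1)) * (Delta φ x)⁻¹)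

/-- The small phase space: `∂v = 1`, `∂u = 0`, and `∂ⁿv = ∂ⁿu = 0` for `n > 1`, with
`u ∉ (-∞, 0]`. -/
def smallPhase : Set Jet :=
  {x | x (0, 1) ∈ slitPlane ∧ x (1, 0) = 1 ∧ x (1, 1) = 0 ∧ ∀ n, 1 < n → ∀ a, x (n, a) = 0}

/-- `F` and the functions `∂_{1,a} F` vanish on the small phase space. -/
def VanishesOnSmall (φ : ℂ → ℂ) (F : Jet → ℂ) : Prop :=
  (∀ x ∈ smallPhase, F x = 0) ∧ ∀ a, ∀ x ∈ smallPhase, d1 φ a F x = 0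

end TwoPrimary

end

/-! The proof combines polynomial identities, checked by normal forms, with the triangular shape of
the fields ð_{k,a}.

All given functions are polynomials with rational coefficients in Δ⁻¹, the jets u^a_n and the
derivatives φ⁽ᵏ⁾, ψ⁽ᵏ⁾, subject to Δ⁻¹((∂v)² - φ'(∂u)²) = 1; orders n, k ≤ 4 suffice for the
identities needed. `Rep` says that a function on the jet space is the value of such an expression,
and by `Rep.field_ext` the vector fields act on it as formal derivations. So the commutator formula
(`isZero_commutator`) and the properties of F_{2,0} + F_{2,1} (`isZero_F2P`) are computations in
this ring, for some of the latter modulo genusOne = 0 and its derivative in u.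

In ð_{k,a} the coefficient of ∂/∂u^b_n is 0 for n < k and (∂U^{k+1})_a^b for n = k, an invertible
matrix where Δ ≠ 0. Hence a function of finitely many jets that is killed by all ð_{n,a}, n ≥ k ≥ 1,
does not depend on the u^b_n with n ≥ k (`pd_eq_zero_of_eth`). In particular, two solutions of
(TRR21) differ by a function of the jets of order at most 1. Only fields with k ≥ 1 are applied to
an unknown solution; they do not differentiate in v and u, so its coefficients may be treated as
constants.

Necessity (`genusOne_eq_zero`): `T2P` gives a function T that solves (TRR21) for all φ, ψ. If F is a
solution, then E = R_{1,1,0,0} - ð_{1,1,0,0}T equals ð_{1,1,0,0}(F - T). This operator preserves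
functions of the jets of order at most 1, so ð_{2,0}E = 0. But ð_{2,0}E is computed to be minus the
right side of the commutator formula, so genusOne vanishes. No commutation relation between the
operators is needed.

Uniqueness (`eq_zero_of_eth11`): the difference H of two solutions satisfies ð_{1,a}ð_{1,b}H =
3⟨⟨O_a O_b O^c⟩⟩_0 ð_{1,c}H, a linear system for the vector of the ð_{1,b}H with integrating factor
(∂U)⁻³. The vector J = (∂U)⁻³ ð_1 H is killed by all ð_{1,a}, so it depends on (v, u) only. The
small phase space has a point over each (v, u), and J vanishes there; so J = 0 and ð_1 H = 0. The
same argument then gives H = 0. -/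

namespace TwoPrimary

/-! ### Sparse integer polynomials and their reduction modulo the relation for Δ⁻¹. -/

/-- Polynomials with integer coefficients, as lists of monomials. The exponents of a monomial
are the digits of a natural number in base 256. -/
inductive Terms where
  | nil : Terms
  | cons (m : ℕ) (c : ℤ) (t : Terms) : Terms

/-- The number of variables that may occur in a list of monomials. -/
abbrev numVars : ℕ := 22

/-- The product of the `val (i + k) ^ e`, where `e` is the `k`-th digit of `m`, `k < n`. -/
def mono (val : ℕ → ℂ) : ℕ → ℕ → ℕ → ℂ
  | 0, _, _ => 1
  | n + 1, i, m => val i ^ (m % 256) * mono val n (i + 1) (m / 256)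

/-- The derivative of `mono val n i m` in the direction `w`. -/
def dmono (val w : ℕ → ℂ) : ℕ → ℕ → ℕ → ℂ
  | 0, _, _ => 0
  | n + 1, i, m => ((m % 256 : ℕ) : ℂ) * val i ^ (m % 256 - 1) * w i * mono val n (i + 1) (m / 256)
      + val i ^ (m % 256) * dmono val w n (i + 1) (m / 256)

namespace Terms

/-- The value of a polynomial. -/
def ev (val : ℕ → ℂ) : Terms → ℂ
  | nil => 0
  | cons m c t => c * mono val numVars 0 m + ev val t

/-- The derivative of a polynomial in the direction `w`. -/
def dev (val w : ℕ → ℂ) : Terms → ℂ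
  | nil => 0
  | cons m c t => c * dmono val w numVars 0 m + dev val w t

/-- Merge the monomial `c * m`, followed by a list `p`, into a list; `f` merges with `p`. -/
def addAux (m : ℕ) (c : ℤ) (p : Terms) (f : Terms → Terms) : Terms → Terms
  | nil => cons m c p
  | cons n d q =>
      cond (Nat.ble m n)
        (cond (Nat.beq m n)
          (cond (decide (c + d = 0)) (f q) (cons m (c + d) (f q)))
          (cons m c (f (cons n d q))))
        (cons n d (addAux m c p f q))

/-- The sum of two polynomials. -/
def add : Terms → Terms → Terms
  | nil => fun q => q
  | cons m c p => fun q => addAux m c p (add p) q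

/-- The product of a polynomial with the monomial `c * m`. -/
def mulTerm (m : ℕ) (c : ℤ) : Terms → Terms
  | nil => nil
  | cons n d q => cons (m + n) (c * d) (mulTerm m c q)

/-- The product of two polynomials. -/
def mul : Terms → Terms → Terms
  | nil, _ => nil
  | cons m c p, q => add (mulTerm m c q) (mul p q)

/-- All digits are less than 128. -/
def valid : Terms → Bool
  | nil => true
  | cons m _ p => cond (Nat.beq (Nat.land m (128 * ((256 ^ numVars - 1) / 255))) 0) (valid p) false

/-- The partial derivative with respect to the variable `i`, where `q = 256 ^ i`. -/
def pdiff (q : ℕ) : Terms → Terms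
  | nil => nil
  | cons m c p =>
      cond (Nat.beq (m / q % 256) 0) (pdiff q p) (cons (m - q) (c * (m / q % 256 : ℕ)) (pdiff q p))

/-- Divisibility of a monomial by the variable `0` and the square of the variable `6`. The
exponents of the variables `7` and `8` must leave room for the reduction. -/
def reducible (m : ℕ) : Bool :=
  Nat.ble 1 (m % 256) && (Nat.ble 2 (m / 256 ^ 6 % 256)
    && (Nat.ble (m / 256 ^ 7 % 256) 250 && Nat.ble (m / 256 ^ 8 % 256) 250))

/-- The monomials that are `reducible`, or those that are not. -/
def part (b : Bool) : Terms → Terms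
  | nil => nil
  | cons m c p => cond (reducible m == b) (cons m c (part b p)) (part b p)

/-- Replace every monomial `m` by `m - a + b`. -/
def shift (a b : ℕ) : Terms → Terms
  | nil => nil
  | cons m c p => cons (m - a + b) c (shift a b p)

/-- Reduction by means of the relation `x₀ x₆² = 1 + x₀ x₇² x₈`. -/
def reduce : ℕ → Terms → Terms
  | 0, p => p
  | n + 1, p =>
      match part true p with
      | nil => p
      | cons m c h => reduce n (add (part false p)
          (add (shift (2 * 256 ^ 6 + 1) 0 (cons m c h))
            (shift (2 * 256 ^ 6) (2 * 256 ^ 7 + 256 ^ 8) (cons m c h))))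

end Terms

/-- Digits below 128 add without carry in base 256; this is what `Terms.valid` guarantees before two
polynomials are multiplied. -/
theorem mono_add (val : ℕ → ℂ) (n i m m' : ℕ)
    (h : ∀ k < n, m / 256 ^ k % 256 < 128) (h' : ∀ k < n, m' / 256 ^ k % 256 < 128) :
    mono val n i (m + m') = mono val n i m * mono val n i m' := by
  induction n generalizing i m m' with
  | zero => simp [mono]
  | succ n ih =>
    have h0 := h 0 (by omega)
    have h0' := h' 0 (by omega)
    simp only [pow_zero, Nat.div_one] at h0 h0'
    have e1 : (m + m') % 256 = m % 256 + m' % 256 := by omega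
    have e2 : (m + m') / 256 = m / 256 + m' / 256 := by omega
    simp only [mono, e1, e2]
    rw [ih, pow_add]
    · ring
    · intro k hk
      have := h (k + 1) (by omega)
      rwa [pow_succ', ← Nat.div_div_eq_div_mul] at this
    · intro k hk
      have := h' (k + 1) (by omega)
      rwa [pow_succ', ← Nat.div_div_eq_div_mul] at this

theorem mono_zero (val : ℕ → ℂ) (n i : ℕ) : mono val n i 0 = 1 := by
  induction n generalizing i with
  | zero => rfl
  | succ n ih => simp [mono, ih]

theorem mono_pow_add (val : ℕ → ℂ) (n i k m : ℕ) (hk : k < n) (hm : m / 256 ^ k % 256 < 255) :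
    mono val n i (m + 256 ^ k) = val (i + k) * mono val n i m := by
  induction n generalizing i k m with
  | zero => omega
  | succ n ih =>
    cases k with
    | zero =>
      simp only [pow_zero, Nat.div_one] at hm
      have e1 : (m + 256 ^ 0) % 256 = m % 256 + 1 := by simp; omega
      have e2 : (m + 256 ^ 0) / 256 = m / 256 := by simp; omega
      simp only [mono, e1, e2, pow_succ, add_zero]
      ring
    | succ k =>
      have e1 : (m + 256 ^ (k + 1)) % 256 = m % 256 := by rw [pow_succ]; omega
      have e2 : (m + 256 ^ (k + 1)) / 256 = m / 256 + 256 ^ k := by rw [pow_succ]; omega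
      simp only [mono, e1, e2]
      rw [ih _ _ _ (by omega), show i + 1 + k = i + (k + 1) by ring]
      · ring
      · rwa [pow_succ', ← Nat.div_div_eq_div_mul] at hm

theorem digit_sub (m k : ℕ) (h : 1 ≤ m / 256 ^ k % 256) :
    (m - 256 ^ k) / 256 ^ k % 256 = m / 256 ^ k % 256 - 1 ∧ m - 256 ^ k + 256 ^ k = m := by
  have hp : 0 < 256 ^ k := by positivity
  have hle : 256 ^ k ≤ m := by
    by_contra hlt
    rw [Nat.div_eq_of_lt (by omega)] at h
    omega
  have : (m - 256 ^ k) / 256 ^ k = m / 256 ^ k - 1 := by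
    have := Nat.sub_mul_div m (256 ^ k) 1
    simpa using this
  rw [this]
  generalize m / 256 ^ k = d at *
  omega

theorem mono_eq_mul (val : ℕ → ℂ) (n i k m : ℕ) (hk : k < n) (hm : 1 ≤ m / 256 ^ k % 256) :
    mono val n i m = val (i + k) * mono val n i (m - 256 ^ k) := by
  have h := digit_sub m k hm
  rw [← mono_pow_add val n i k _ hk (by omega), h.2]

theorem dmono_eq_sum (val w : ℕ → ℂ) (n i m : ℕ) :
    dmono val w n i m = ∑ k ∈ Finset.range n,
      ((m / 256 ^ k % 256 : ℕ) : ℂ) * mono val n i (m - 256 ^ k) * w (i + k) := by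
  induction n generalizing i m with
  | zero => simp [dmono]
  | succ n ih =>
    rw [Finset.sum_range_succ', dmono, ih, Finset.mul_sum, add_comm]
    congr 1
    · refine Finset.sum_congr rfl fun k _ => ?_
      rw [pow_succ', ← Nat.div_div_eq_div_mul, show i + 1 + k = i + (k + 1) by ring]
      -- If the exponent is 0, the subtraction borrows or truncates and gives a meaningless
      -- monomial, but its coefficient is the exponent.
      by_cases h : m / 256 / 256 ^ k % 256 = 0
      · simp [h]
      · have h1 := digit_sub (m / 256) k (by omega)
        have e1 : (m - 256 * 256 ^ k) % 256 = m % 256 := by omega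
        have e2 : (m - 256 * 256 ^ k) / 256 = m / 256 - 256 ^ k := by omega
        simp only [mono, e1, e2]
        ring
    · simp only [pow_zero, Nat.div_one, add_zero]
      by_cases h : m % 256 = 0
      · simp [h]
      · have e1 : (m - 1) % 256 = m % 256 - 1 := by omega
        have e2 : (m - 1) / 256 = m / 256 := by omega
        simp only [mono, e1, e2]
        ring

theorem hasDerivAt_mono {val : ℂ → ℕ → ℂ} {w : ℕ → ℂ} {t : ℂ}
    (h : ∀ i, HasDerivAt (fun s => val s i) (w i) t) (n i m : ℕ) :
    HasDerivAt (fun s => mono (val s) n i m) (dmono (val t) w n i m) t := by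
  induction n generalizing i m with
  | zero => exact hasDerivAt_const _ _
  | succ n ih => exact ((h i).pow _).mul (ih _ _)

/-- A valuation of the variables that satisfies the relation for the inverse of `Δ`. -/
def IsPoint (val : ℕ → ℂ) : Prop := val 0 * (val 6 ^ 2 - val 7 ^ 2 * val 8) = 1

namespace Terms

theorem ev_addAux (val : ℕ → ℂ) (m : ℕ) (c : ℤ) (p : Terms) (f : Terms → Terms)
    (hf : ∀ q, (f q).ev val = p.ev val + q.ev val) (q : Terms) :
    (addAux m c p f q).ev val = (cons m c p).ev val + q.ev val := by
  induction q with
  | nil => simp [addAux, ev]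
  | cons n d q ih =>
    rw [addAux]
    cases h1 : Nat.ble m n
    · simp only [cond_false, ev, ih]
      ring
    · cases h2 : Nat.beq m n
      · simp only [cond_true, cond_false, ev, hf]
        ring
      · obtain rfl := Nat.eq_of_beq_eq_true h2
        by_cases h3 : c + d = 0
        · have : (c : ℂ) + d = 0 := by exact_mod_cast h3
          simp only [h3, decide_true, cond_true, hf, ev]
          linear_combination -(mono val numVars 0 m) * this
        · simp only [h3, decide_false, cond_true, cond_false, hf, ev]
          push_cast
          ring

theorem ev_add (val : ℕ → ℂ) (p q : Terms) : (add p q).ev val = p.ev val + q.ev val := by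
  induction p generalizing q with
  | nil => simp [add, ev]
  | cons m c p ih => exact ev_addAux val m c p (add p) ih q

theorem lt_of_land {m : ℕ} (h : Nat.land m (128 * ((256 ^ numVars - 1) / 255)) = 0) (k : ℕ)
    (hk : k < numVars) : m / 256 ^ k % 256 < 128 := by
  -- All digits of the mask are 128, and bit 8k + 7 is the top bit of digit k.
  have hG : ∀ k < numVars, (128 * ((256 ^ numVars - 1) / 255)).testBit (8 * k + 7) = true := by
    decide
  have h1 : (Nat.land m (128 * ((256 ^ numVars - 1) / 255))).testBit (8 * k + 7) = false := by
    rw [h]; simp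
  have h2 : m.testBit (8 * k + 7) = false := by
    have := Nat.testBit_and m (128 * ((256 ^ numVars - 1) / 255)) (8 * k + 7)
    rw [hG k hk, Bool.and_true] at this
    rw [← this]
    exact h1
  rw [Nat.testBit_eq_decide_div_mod_eq, pow_add, pow_mul, ← Nat.div_div_eq_div_mul] at h2
  norm_num at h2
  omega

theorem ev_mulTerm (val : ℕ → ℂ) (m : ℕ) (c : ℤ) (q : Terms)
    (hm : ∀ k < numVars, m / 256 ^ k % 256 < 128) (hq : q.valid = true) :
    (mulTerm m c q).ev val = c * mono val numVars 0 m * q.ev val := by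
  induction q with
  | nil => simp [mulTerm, ev]
  | cons n d q ih =>
    rw [valid] at hq
    cases h : Nat.beq (Nat.land n (128 * ((256 ^ numVars - 1) / 255))) 0 <;> rw [h] at hq
    · simp at hq
    · rw [mulTerm, ev, ev, ih hq, mono_add _ _ _ _ _ hm (lt_of_land (Nat.eq_of_beq_eq_true h))]
      push_cast
      ring

theorem ev_mul (val : ℕ → ℂ) (p q : Terms) (hp : p.valid = true) (hq : q.valid = true) :
    (mul p q).ev val = p.ev val * q.ev val := by
  induction p with
  | nil => simp [mul, ev]
  | cons m c p ih =>
    rw [valid] at hp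
    cases h : Nat.beq (Nat.land m (128 * ((256 ^ numVars - 1) / 255))) 0 <;> rw [h] at hp
    · simp at hp
    · rw [mul, ev_add, ih hp, ev_mulTerm _ _ _ _ (lt_of_land (Nat.eq_of_beq_eq_true h)) hq, ev]
      ring

theorem dev_eq_sum (val w : ℕ → ℂ) (p : Terms) :
    p.dev val w = ∑ k ∈ Finset.range numVars, (pdiff (256 ^ k) p).ev val * w k := by
  induction p with
  | nil => simp [dev, pdiff, ev]
  | cons m c p ih =>
    rw [dev, ih, dmono_eq_sum, Finset.mul_sum, ← Finset.sum_add_distrib]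
    refine Finset.sum_congr rfl fun k _ => ?_
    rw [pdiff]
    cases h : Nat.beq (m / 256 ^ k % 256) 0
    · rw [cond_false, ev, zero_add, Int.cast_mul, Int.cast_natCast]
      ring
    · rw [cond_true, Nat.eq_of_beq_eq_true h]
      simp

theorem hasDerivAt_ev {val : ℂ → ℕ → ℂ} {w : ℕ → ℂ} {t : ℂ}
    (h : ∀ i, HasDerivAt (fun s => val s i) (w i) t) (p : Terms) :
    HasDerivAt (fun s => p.ev (val s)) (p.dev (val t) w) t := by
  induction p with
  | nil => exact hasDerivAt_const _ _
  | cons m c p ih => exact ((hasDerivAt_mono h _ _ _).const_mul _).add ih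

theorem ev_part (val : ℕ → ℂ) (p : Terms) :
    (part true p).ev val + (part false p).ev val = p.ev val := by
  induction p with
  | nil => simp [part, ev]
  | cons m c p ih =>
    cases h : reducible m <;> simp [part, h, ev, ← ih, add_assoc, add_left_comm]

/-- This is the relation x₀x₆² = 1 + x₀x₇²x₈ times a monomial: the first summand drops x₀x₆², the
second exchanges x₆² for x₇²x₈. -/
theorem mono_reducible {val : ℕ → ℂ} (hv : IsPoint val) {m : ℕ} (h : reducible m = true) :
    mono val numVars 0 m = mono val numVars 0 (m - (2 * 256 ^ 6 + 1) + 0)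
      + mono val numVars 0 (m - 2 * 256 ^ 6 + (2 * 256 ^ 7 + 256 ^ 8)) := by
  simp only [reducible, Bool.and_eq_true, Nat.ble_eq] at h
  obtain ⟨h0, h6, h7, h8⟩ := h
  have e1 : mono val numVars 0 m = val 6 ^ 2 * mono val numVars 0 (m - 2 * 256 ^ 6) := by
    rw [mono_eq_mul val numVars 0 6 m (by norm_num) (by omega),
      mono_eq_mul val numVars 0 6 (m - 256 ^ 6) (by norm_num) (by omega),
      show m - 256 ^ 6 - 256 ^ 6 = m - 2 * 256 ^ 6 by omega]
    ring
  have e2 : mono val numVars 0 (m - 2 * 256 ^ 6)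
      = val 0 * mono val numVars 0 (m - (2 * 256 ^ 6 + 1) + 0) := by
    rw [mono_eq_mul val numVars 0 0 (m - 2 * 256 ^ 6) (by norm_num) (by omega),
      show m - 2 * 256 ^ 6 - 256 ^ 0 = m - (2 * 256 ^ 6 + 1) + 0 by omega]
  have e3 : mono val numVars 0 (m - 2 * 256 ^ 6 + (2 * 256 ^ 7 + 256 ^ 8))
      = val 7 ^ 2 * val 8 * mono val numVars 0 (m - 2 * 256 ^ 6) := by
    rw [show m - 2 * 256 ^ 6 + (2 * 256 ^ 7 + 256 ^ 8)
        = m - 2 * 256 ^ 6 + 256 ^ 8 + 256 ^ 7 + 256 ^ 7 by omega,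
      mono_pow_add val numVars 0 7 _ (by norm_num) (by omega),
      mono_pow_add val numVars 0 7 _ (by norm_num) (by omega),
      mono_pow_add val numVars 0 8 _ (by norm_num) (by omega)]
    ring
  rw [e1, e3, e2]
  unfold IsPoint at hv
  linear_combination (mono val numVars 0 (m - (2 * 256 ^ 6 + 1) + 0)) * hv

theorem ev_shift_part {val : ℕ → ℂ} (hv : IsPoint val) (p : Terms) :
    (shift (2 * 256 ^ 6 + 1) 0 (part true p)).ev val
      + (shift (2 * 256 ^ 6) (2 * 256 ^ 7 + 256 ^ 8) (part true p)).ev val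
      = (part true p).ev val := by
  induction p with
  | nil => simp [part, shift, ev]
  | cons m c p ih =>
    cases h : reducible m
    · simp only [part, h]
      exact ih
    · simp only [part, h, beq_self_eq_true, cond_true, shift, ev, ← ih, mono_reducible hv h]
      ring

/-- Each pass preserves the value, so the number of passes only affects whether a normal form is
reached, never correctness. -/
theorem ev_reduce {val : ℕ → ℂ} (hv : IsPoint val) (n : ℕ) (p : Terms) :
    (reduce n p).ev val = p.ev val := by
  induction n generalizing p with
  | zero => rfl
  | succ n ih =>
    rw [reduce]
    split
    · rfl
    · next m c h hp =>
      rw [ih, ev_add, ev_add, ← hp, ev_shift_part hv, add_comm, ev_part]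

end Terms

end TwoPrimary

/-! ### Expressions, formal derivations, and symbolic counterparts of the functions in the theorem.
-/

namespace TwoPrimary

/-- Polynomial expressions: polynomials in normal form, variables, further leaves, sums and
products. -/
inductive Ex (β : Type) where
  | nf (l : Terms) : Ex β
  | var (i : ℕ) : Ex β
  | leaf (b : β) : Ex β
  | plus (p q : Ex β) : Ex β
  | times (p q : Ex β) : Ex β

namespace Ex

variable {β : Type}

/-- The value of an expression. -/
def ev (val : ℕ → ℂ) (lv : β → ℂ) : Ex β → ℂ
  | nf l => l.ev val
  | var i => val i
  | leaf b => lv b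
  | plus p q => ev val lv p + ev val lv q
  | times p q => ev val lv p * ev val lv q

/-- The derivative of an expression in the direction `w`, where leaves are constant. -/
def dev (val : ℕ → ℂ) (lv : β → ℂ) (w : ℕ → ℂ) : Ex β → ℂ
  | nf l => l.dev val w
  | var i => w i
  | leaf _ => 0
  | plus p q => dev val lv w p + dev val lv w q
  | times p q => dev val lv w p * ev val lv q + ev val lv p * dev val lv w q

/-- The sum of two expressions, in normal form if both are. -/
def add : Ex β → Ex β → Ex β
  | nf a, nf b => nf (a.add b)
  | p, q => plus p q

/-- The product of two expressions, in normal form if both are. -/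
def mul : Ex β → Ex β → Ex β
  | nf .nil, _ => nf .nil
  | nf a, nf b => cond (a.valid && b.valid) (nf ((a.mul b).reduce 40)) (times (nf a) (nf b))
  | p, q => times p q

/-- An integer constant. -/
def int (c : ℤ) : Ex β := nf (.cons 0 c .nil)

instance : Add (Ex β) := ⟨add⟩
instance : Mul (Ex β) := ⟨mul⟩
instance : Zero (Ex β) := ⟨nf .nil⟩
instance : SMul ℤ (Ex β) := ⟨fun c p => int c * p⟩
instance : Sub (Ex β) := ⟨fun p q => p + int (-1) * q⟩

/-- A variable, in normal form if possible. -/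
def x (i : ℕ) : Ex β := cond (Nat.blt i numVars) (nf (.cons (256 ^ i) 1 .nil)) (var i)

/-- Expressions without leaves as expressions with leaves. -/
def lift : Ex Empty → Ex β
  | nf l => nf l
  | var i => var i
  | plus p q => plus (lift p) (lift q)
  | times p q => times (lift p) (lift q)

/-- The sum of the `X k * ∂p/∂x_k` over `k < n`. -/
def derTerms (X : ℕ → Ex Empty) (l : Terms) : ℕ → Ex β
  | 0 => 0
  | n + 1 =>
      match l.pdiff (256 ^ n) with
      | .nil => derTerms X l n
      | .cons m c t => derTerms X l n + nf (.cons m c t) * lift (X n)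

/-- The derivation that maps the variable `i` to `X i` and is zero on leaves. -/
def der (X : ℕ → Ex Empty) : Ex β → Ex β
  | nf l => derTerms X l numVars
  | var i => lift (X i)
  | leaf _ => 0
  | plus p q => der X p + der X q
  | times p q => der X p * q + p * der X q

/-- A test for zero. -/
def isZero : Ex β → Bool
  | nf .nil => true
  | _ => false

/-- The partial derivative of a normal form. -/
def pdiff (i : ℕ) : Ex β → Ex β
  | nf l => nf (l.pdiff (256 ^ i))
  | _ => 0

/-- The variable `u^a_n`. -/
def jet (n : ℕ) (a : Fin 2) : Ex β := x (4 * n + a + 2)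

/-- The variable `φ⁽ᵏ⁾`. -/
def phi (k : ℕ) : Ex β := x (4 * k + 4)

/-- The variable `ψ⁽ᵏ⁾`. -/
def psi (k : ℕ) : Ex β := x (4 * k + 5)

/-- The sum over an index. -/
def sum (f : Fin 2 → Ex β) : Ex β := f 0 + f 1

end Ex

open Ex

/-- The images of all variables under the derivation with given images of the jet variables. -/
def ext (ξ : ℕ → Fin 2 → Ex Empty) : ℕ → Ex Empty
  -- The variable 0 is Δ⁻¹, so its derivative is -Δ⁻² ξ(Δ) with Δ = (∂v)² - φ'(∂u)².
  | 0 => (-1 : ℤ) • (x 0 * x 0 * ((2 : ℤ) • (jet 1 0 * ξ 1 0)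
      - (2 : ℤ) • (phi 1 * jet 1 1 * ξ 1 1) - phi 2 * jet 1 1 * jet 1 1 * ξ 0 1))
  | 1 => 0
  | i + 2 =>
      match i % 4 with
      | 0 => ξ (i / 4) 0
      | 1 => ξ (i / 4) 1
      -- Here the variable i + 2 is φ⁽ᵏ⁾(u) or ψ⁽ᵏ⁾(u), and four places further on is the derivative
      -- of order k + 1.
      | _ => ξ 0 1 * x (i + 6)

/-- The derivation that represents `∂`. -/
def dtotP {β : Type} : Ex β → Ex β := der (ext fun n a => jet (n + 1) a)

/-- The matrix `∂U`. -/
def dUP (a b : Fin 2) : Ex Empty := !![jet 1 0, jet 1 1; phi 1 * jet 1 1, jet 1 0] a b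

/-- The matrices `faa`. -/
def faaP : ℕ → ℕ → Fin 2 → Fin 2 → Ex Empty
  | 0, 0 => dUP
  | 0, _ + 1 => fun _ _ => 0
  | n + 1, 0 => fun a b => dtotP (faaP n 0 a b)
  | n + 1, k + 1 => fun a b =>
      dtotP (faaP n (k + 1) a b) + sum fun c => dUP a c * faaP n k c b

/-- The derivation that represents `ð_{k,a}`. -/
def ethP {β : Type} (k : ℕ) (a : Fin 2) : Ex β → Ex β := der (ext fun n b => faaP n k a b)

/-- The function `⟨⟨O_a O_b⟩⟩_0`. -/
def twoPtP (a b : Fin 2) : Ex Empty := !![jet 0 1, jet 0 0; jet 0 0, phi 0] a b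

/-- Genus 0 correlators. -/
def corr0P (a b : Fin 2) (l : List (Fin 2)) : Ex Empty := l.foldr (ethP 0) (twoPtP a b)

/-- The determinant `Δ`. -/
def DeltaP : Ex Empty := jet 1 0 * jet 1 0 - jet 1 1 * (phi 1 * jet 1 1)

/-- Genus 1 correlators, multiplied by 24. -/
def corr1P (a : Fin 2) (l : List (Fin 2)) : Ex Empty :=
  l.foldr (ethP 0) (x 0 * ethP 0 a DeltaP + (24 : ℤ) • ethP 0 a (psi 0))

/-- The right hand sides `R_{k,a}`. -/
def RP (k : ℕ) (a : Fin 2) : Ex Empty :=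
  match k with
  | 2 => x 1 * sum fun b => sum fun c =>
        corr0P a b [c] * ((7 : ℤ) • (corr1P (up b) [] * corr1P (up c) [])
            + (24 : ℤ) • corr1P (up b) [up c])
        + (13 : ℤ) • (corr0P a b [c, up c] * corr1P (up b) [])
        - corr1P a [up b] * corr0P b c [up c]
        + (6 : ℤ) • corr0P a b [up b, c, up c]
  | 3 => x 1 * sum fun b => sum fun c => sum fun d =>
        corr0P a b [c] * ((12 : ℤ) • (corr1P (up b) [] * corr0P (up c) (up d) [d])
            + (12 : ℤ) • corr0P (up b) (up c) [up d, d])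
        + (5 : ℤ) • (corr0P a (up b) [up c, c] * corr0P b (up d) [d])
  | 4 => x 1 * sum fun b => sum fun c => sum fun d => sum fun e =>
        (5 : ℤ) • (corr0P a (up b) [up c] * corr0P b c [up d] * corr0P d (up e) [e])
  | _ => 0

/-- The operators `ð_{1,1,a,b}`. -/
def eth11P {β : Type} (a b : Fin 2) (F : Ex β) : Ex β :=
  ethP 1 a (ethP 1 b F) - (3 : ℤ) • sum fun c => lift (corr0P a b [up c]) * ethP 1 c F

/-- The right hand sides `R_{1,1,a,b}`. -/
def R11P (a b : Fin 2) : Ex Empty :=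
  x 1 * sum fun c => sum fun d =>
    (13 : ℤ) • (corr0P a b [c, d] * corr1P (up c) [] * corr1P (up d) [])
    + (8 : ℤ) • ((corr1P a [c] * corr1P d [] + corr1P a [c, d]) * corr0P b (up c) [up d])
    + (8 : ℤ) • (corr0P a (up c) [up d] * (corr1P b [c] * corr1P d [] + corr1P b [c, d]))
    - (8 : ℤ) • (corr0P a b [c]
        * (corr1P (up c) [d] * corr1P (up d) [] + corr1P (up c) [d, up d]))
    + (5 : ℤ) • (corr0P a c [d, up d] * corr1P (up c) [b])
    + (5 : ℤ) • (corr1P a [c] * corr0P b (up c) [d, up d])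
    + (23 : ℤ) • (corr0P a b [c, d, up d] * corr1P (up c) [])
    - (3 : ℤ) • (corr1P a [b, c] * corr0P (up c) (up d) [d])
    + (56 : ℤ) • (corr0P a b [c, d] * corr1P (up c) [up d])
    + (10 : ℤ) • corr0P a b [c, up c, d, up d]

/-- The function `genusOne`, multiplied by 24. -/
def genusOneP : Ex Empty :=
  phi 3 + (24 : ℤ) • (phi 2 * psi 1) - (48 : ℤ) • (phi 1 * psi 2)

/-- The inverse of `∂U` with raised indices. -/
def propP (a b : Fin 2) : Ex Empty :=
  !![x 0 * jet 1 0, (-1 : ℤ) • (x 0 * jet 1 1);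
    (-1 : ℤ) • (x 0 * (phi 1 * jet 1 1)), x 0 * jet 1 0] (up a) b

/-- The derivatives `∂ⁿ` of genus 0 correlators. -/
def vertP (n : ℕ) (a b : Fin 2) (l : List (Fin 2)) : Ex Empty := dtotP^[n] (corr0P a b l)

/-- The derivatives `∂ⁿ` of the derivatives of `ψ`. -/
def psiVertP (n : ℕ) (l : List (Fin 2)) : Ex Empty := dtotP^[n] (l.foldr (ethP 0) (psi 0))

/-- The Feynman graph expression `F_{2,0}`. -/
def F20P : Ex Empty := x 1 * (
  (5 : ℤ) • (sum fun a => sum fun b => sum fun c => sum fun d =>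
    vertP 2 a b [c, d] * propP a b * propP c d)
  - (5 : ℤ) • (sum fun a => sum fun b => sum fun c => sum fun d => sum fun e => sum fun f =>
    vertP 2 a b [] * vertP 1 c d [e, f] * propP a c * propP b d * propP e f)
  - (16 : ℤ) • (sum fun a => sum fun b => sum fun c => sum fun d => sum fun e => sum fun f =>
    vertP 2 a b [c] * vertP 1 d e [f] * propP a d * propP b e * propP c f)
  + (16 : ℤ) • (sum fun a => sum fun b => sum fun c => sum fun d => sum fun e => sum fun f =>
      sum fun g => sum fun h =>
    vertP 2 a b [] * vertP 1 c d [e] * vertP 1 f g [h]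
      * propP a c * propP b f * propP d g * propP e h))

/-- The function `F_{2,1}`. -/
def F21P : Ex Empty := x 1 * (
  (sum fun a => sum fun b => ((120 : ℤ) • psiVertP 1 [a, b]
      + (4608 : ℤ) • (psiVertP 1 [a] * psiVertP 0 [b])) * propP a b)
  + (sum fun a => sum fun b => sum fun c => sum fun d =>
    vertP 2 a b []
      * ((288 : ℤ) • psiVertP 0 [c, d] - (576 : ℤ) • (psiVertP 0 [c] * psiVertP 0 [d]))
      * propP a c * propP b d)
  + (sum fun a => sum fun b => sum fun c => sum fun d =>
    ((168 : ℤ) • (vertP 2 a b [c] * psiVertP 0 [d])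
      - (72 : ℤ) • (vertP 1 a b [c] * psiVertP 1 [d]))
      * propP a b * propP c d)
  + (sum fun a => sum fun b => sum fun c => sum fun d => sum fun e => sum fun f =>
    vertP 2 a b [] * vertP 1 c d [e] * psiVertP 0 [f]
      * ((72 : ℤ) • (propP a f * propP b c * propP d e)
        - (552 : ℤ) • (propP a c * propP b d * propP e f)))
  + (24 : ℤ) • (jet 1 1 * jet 1 1 * jet 1 1 * jet 1 1 * phi 2 * psi 2 * x 0))

/-- The derivative of `genusOneP`. -/
def genusOneP' : Ex Empty :=
  phi 4 + (24 : ℤ) • (phi 3 * psi 1) - (24 : ℤ) • (phi 2 * psi 2) - (48 : ℤ) • (phi 1 * psi 3)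

/-- Elimination of `φ'''` and `φ''''` by means of `genusOne = 0`. -/
def elim (p : Ex Empty) : Ex Empty :=
  -- The variables 20 and 16 are φ'''' and φ'''. Subtracting multiples of functions that vanish is
  -- harmless whatever the degree. It eliminates a variable that occurs linearly, since it has
  -- coefficient 1 in the relation.
  let q := p - pdiff 20 p * genusOneP'
  q - pdiff 16 q * genusOneP

end TwoPrimary

/-! ### Evaluation of expressions, and their differentials as linear functions of the direction. -/

namespace TwoPrimary

namespace Ex

variable {β : Type} {val : ℕ → ℂ} {lv : β → ℂ}

theorem ev_add (p q : Ex β) : (p + q).ev val lv = p.ev val lv + q.ev val lv := by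
  change (add p q).ev val lv = _
  cases p <;> cases q <;> first | exact Terms.ev_add _ _ _ | rfl

theorem ev_mul (hv : IsPoint val) (p q : Ex β) :
    (p * q).ev val lv = p.ev val lv * q.ev val lv := by
  change (mul p q).ev val lv = _
  unfold mul
  split
  · simp [ev, Terms.ev]
  · next a b _ =>
    cases h : a.valid && b.valid
    · rfl
    · rw [Bool.and_eq_true] at h
      simp [ev, Terms.ev_reduce hv, Terms.ev_mul _ _ _ h.1 h.2]
  · rfl

theorem ev_int (c : ℤ) : (int c : Ex β).ev val lv = c := by
  simp [int, ev, Terms.ev, mono_zero]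

theorem ev_smul (hv : IsPoint val) (c : ℤ) (p : Ex β) :
    (c • p).ev val lv = c * p.ev val lv := by
  change (int c * p).ev val lv = _
  rw [ev_mul hv, ev_int]

theorem ev_sub (hv : IsPoint val) (p q : Ex β) :
    (p - q).ev val lv = p.ev val lv - q.ev val lv := by
  change (p + int (-1) * q).ev val lv = _
  rw [ev_add, ev_mul hv, ev_int]
  push_cast
  ring

theorem ev_x (i : ℕ) : (x i : Ex β).ev val lv = val i := by
  unfold x
  cases h : Nat.blt i numVars
  · rfl
  · have hi : i < numVars := by simpa using h
    have : mono val numVars 0 (0 + 256 ^ i) = _ :=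
      mono_pow_add val numVars 0 i 0 hi (by simp)
    simp only [zero_add, mono_zero, mul_one] at this
    simp [ev, Terms.ev, this]

theorem ev_sum (f : Fin 2 → Ex β) : (sum f).ev val lv = ∑ b, (f b).ev val lv := by
  rw [sum, ev_add, Fin.sum_univ_two]

theorem ev_lift (p : Ex Empty) (l : Empty → ℂ) : (lift p : Ex β).ev val lv = p.ev val l := by
  induction p with
  | nf l => rfl
  | var i => rfl
  | leaf b => exact b.elim
  | plus p q hp hq => simp [lift, ev, hp, hq]
  | times p q hp hq => simp [lift, ev, hp, hq]

theorem ev_derTerms (hv : IsPoint val) (X : ℕ → Ex Empty) (l : Terms) (e : Empty → ℂ) (n : ℕ) :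
    (derTerms X l n : Ex β).ev val lv
      = ∑ k ∈ Finset.range n, (l.pdiff (256 ^ k)).ev val * (X k).ev val e := by
  induction n with
  | zero => rfl
  | succ n ih =>
    rw [Finset.sum_range_succ, derTerms]
    split
    · next h => rw [ih, h]; simp [Terms.ev]
    · next h => rw [ev_add, ih, h, ev_mul hv, ev_lift _ e]; rfl

theorem ev_der (hv : IsPoint val) (X : ℕ → Ex Empty) (e : Empty → ℂ) (p : Ex β) :
    (der X p).ev val lv = p.dev val lv fun i => (X i).ev val e := by
  induction p with
  | nf l => rw [der, ev_derTerms hv X l e, dev, Terms.dev_eq_sum]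
  | var i => rw [der, ev_lift _ e]; rfl
  | leaf b => rfl
  | plus p q hp hq => rw [der, ev_add, hp, hq]; rfl
  | times p q hp hq => rw [der, ev_add, ev_mul hv, ev_mul hv, hp, hq]; rfl

theorem ev_eq_zero {p : Ex β} (h : p.isZero = true) : p.ev val lv = 0 := by
  unfold isZero at h
  split at h
  · rfl
  · simp at h

theorem hasDerivAt_ev {val : ℂ → ℕ → ℂ} {w : ℕ → ℂ} {t : ℂ}
    (h : ∀ i, HasDerivAt (fun s => val s i) (w i) t) (p : Ex β) :
    HasDerivAt (fun s => p.ev (val s) lv) (p.dev (val t) lv w) t := by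
  induction p with
  | nf l => exact Terms.hasDerivAt_ev h l
  | var i => exact h i
  | leaf b => exact hasDerivAt_const _ _
  | plus p q hp hq => exact hp.add hq
  | times p q hp hq => exact hp.mul hq

theorem dev_linear (a : ℂ) (w w' : ℕ → ℂ) (p : Ex β) :
    p.dev val lv (a • w + w') = a * p.dev val lv w + p.dev val lv w' := by
  induction p with
  | nf l =>
    simp only [dev, Terms.dev_eq_sum, Finset.mul_sum, ← Finset.sum_add_distrib]
    exact Finset.sum_congr rfl fun k _ => by simp; ring
  | var i => simp [dev]
  | leaf b => simp [dev]
  | plus p q hp hq => rw [dev, hp, hq, dev, dev]; ring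
  | times p q hp hq => rw [dev, hp, hq, dev, dev]; ring

/-- The derivative of an expression as a linear function of the direction. -/
def devL (val : ℕ → ℂ) (lv : β → ℂ) (p : Ex β) : (ℕ → ℂ) →ₗ[ℂ] ℂ where
  toFun w := p.dev val lv w
  map_add' w w' := by simpa using dev_linear 1 w w' p
  map_smul' a w := by
    have h0 : p.dev val lv 0 = 0 := by
      have := dev_linear (val := val) (lv := lv) 1 0 0 p
      simp only [smul_zero, add_zero, one_mul] at this
      linear_combination -this
    simpa [h0] using dev_linear (val := val) (lv := lv) a w 0 p

/-- An expression has finitely many variables; the bound does not depend on the point. This makes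
the sums over all jets finite. -/
theorem exists_dev_congr (p : Ex β) : ∃ N, ∀ val lv w w',
    (∀ i < N, w i = w' i) → p.dev val lv w = p.dev val lv w' := by
  induction p with
  | nf l =>
    refine ⟨numVars, fun val lv w w' h => ?_⟩
    simp only [dev, Terms.dev_eq_sum]
    exact Finset.sum_congr rfl fun k hk => by rw [h k (Finset.mem_range.1 hk)]
  | var i => exact ⟨i + 1, fun val lv w w' h => h i (by omega)⟩
  | leaf b => exact ⟨0, fun _ _ _ _ _ => rfl⟩
  | plus p q hp hq =>
    obtain ⟨M, hM⟩ := hp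
    obtain ⟨N, hN⟩ := hq
    refine ⟨max M N, fun val lv w w' h => ?_⟩
    rw [dev, dev, hM val lv w w' fun i hi => h i (lt_max_of_lt_left hi),
      hN val lv w w' fun i hi => h i (lt_max_of_lt_right hi)]
  | times p q hp hq =>
    obtain ⟨M, hM⟩ := hp
    obtain ⟨N, hN⟩ := hq
    refine ⟨max M N, fun val lv w w' h => ?_⟩
    rw [dev, dev, hM val lv w w' fun i hi => h i (lt_max_of_lt_left hi),
      hN val lv w w' fun i hi => h i (lt_max_of_lt_right hi)]

end Ex

open Ex

/-- The derivatives of all variables when those of the jet variables are given. -/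
def extv (val : ℕ → ℂ) (ξ : ℕ → Fin 2 → ℂ) : ℕ → ℂ
  | 0 => -(val 0 * val 0 * (2 * (val 6 * ξ 1 0) - 2 * (val 8 * val 7 * ξ 1 1)
      - val 12 * val 7 * val 7 * ξ 0 1))
  | 1 => 0
  | i + 2 =>
      match i % 4 with
      | 0 => ξ (i / 4) 0
      | 1 => ξ (i / 4) 1
      | _ => ξ 0 1 * val (i + 6)

theorem ev_ext {val : ℕ → ℂ} (hv : IsPoint val) (e : Empty → ℂ) (ξ : ℕ → Fin 2 → Ex Empty)
    (i : ℕ) : (ext ξ i).ev val e = extv val (fun n b => (ξ n b).ev val e) i := by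
  match i with
  | 0 =>
    simp only [ext, extv, ev_smul hv, ev_mul hv, ev_sub hv, ev_x, jet, phi]
    norm_num
  | 1 => rfl
  | i + 2 =>
    have hj : i % 4 = 0 ∨ i % 4 = 1 ∨ i % 4 = 2 ∨ i % 4 = 3 := by omega
    rcases hj with hj | hj | hj | hj <;> simp only [ext, extv, hj, ev_mul hv, ev_x]

/-- `extv` as a linear map. -/
def extvL (val : ℕ → ℂ) : (ℕ → Fin 2 → ℂ) →ₗ[ℂ] (ℕ → ℂ) where
  toFun := extv val
  map_add' ξ η := by
    funext i
    match i with
    | 0 => simp only [extv, Pi.add_apply]; ring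
    | 1 => simp [extv]
    | i + 2 => simp only [extv, Pi.add_apply]; split <;> ring
  map_smul' a ξ := by
    funext i
    match i with
    | 0 => simp only [extv, Pi.smul_apply, smul_eq_mul, RingHom.id_apply]; ring
    | 1 => simp [extv]
    | i + 2 =>
      simp only [extv, Pi.smul_apply, smul_eq_mul, RingHom.id_apply]
      split <;> ring

/-- The bound 2 is needed because the derivatives of Δ⁻¹, φ⁽ᵏ⁾ and ψ⁽ᵏ⁾ involve jets of order 0 and
1 however small N is. -/
theorem extv_congr {val : ℕ → ℂ} {N : ℕ} {ξ η : ℕ → Fin 2 → ℂ}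
    (h : ∀ n < max N 2, ∀ b, ξ n b = η n b) (i : ℕ) (hi : i < N) : extv val ξ i = extv val η i := by
  have h0 := h 0 (by simp)
  have h1 := h 1 (by simp)
  match i with
  | 0 => simp only [extv, h0, h1]
  | 1 => rfl
  | i + 2 =>
    have h2 := h (i / 4) (lt_max_of_lt_left (by omega))
    simp only [extv, h0, h2]

/-- The family with the value 1 at `(n, b)` and zero elsewhere. -/
def unitVec (n : ℕ) (b : Fin 2) : ℕ → Fin 2 → ℂ := Pi.single n (Pi.single b 1)

/-- The differential is linear and sees finitely many directions, so a vector field with infinitely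
many components can be applied either componentwise or in one step. -/
theorem finsum_dev {β : Type} (val : ℕ → ℂ) (lv : β → ℂ) (c : ℕ → Fin 2 → ℂ) (p : Ex β) :
    ∑ᶠ n : ℕ, ∑ b, c n b * p.dev val lv (extv val (unitVec n b)) = p.dev val lv (extv val c) := by
  obtain ⟨N, hN⟩ := exists_dev_congr p
  have hsupp : (Function.support fun n => ∑ b, c n b * p.dev val lv (extv val (unitVec n b)))
      ⊆ ↑(Finset.range (max N 2)) := by
    intro n hn
    by_contra h
    refine hn (Finset.sum_eq_zero fun b _ => ?_)
    rw [Finset.coe_range, Set.mem_Iio, not_lt] at h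
    have : p.dev val lv (extv val (unitVec n b)) = p.dev val lv (extv val 0) :=
      hN _ _ _ _ (extv_congr fun m hm b' => by
        rw [unitVec, Pi.single_eq_of_ne (by omega)]; rfl)
    rw [this]
    have h0 : p.dev val lv (extv val 0) = (devL val lv p) (extvL val 0) := rfl
    rw [h0, map_zero, map_zero, mul_zero]
  rw [finsum_eq_sum_of_support_subset _ hsupp]
  have hsum : ∑ n ∈ Finset.range (max N 2), ∑ b, c n b * p.dev val lv (extv val (unitVec n b))
      = p.dev val lv (extv val (∑ n ∈ Finset.range (max N 2), ∑ b, c n b • unitVec n b)) := by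
    change _ = devL val lv p (extvL val _)
    simp only [map_sum, map_smul]
    rfl
  rw [hsum]
  refine hN _ _ _ _ (extv_congr fun m hm b => ?_)
  rw [Finset.sum_apply, Finset.sum_eq_single m]
  · simp only [Fin.sum_univ_two, unitVec, Pi.add_apply, Pi.smul_apply, Pi.single_eq_same]
    fin_cases b <;> simp
  · intro n _ hnm
    simp only [Fin.sum_univ_two, unitVec, Pi.add_apply, Pi.smul_apply,
      Pi.single_eq_of_ne (Ne.symm hnm)]
    simp
  · intro h
    exact absurd (Finset.mem_range.2 hm) h

end TwoPrimary

/-! ### Differential calculus on the jet space for functions given by expressions. -/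

namespace TwoPrimary

open Ex

theorem hasDerivAt_iteratedDeriv {f : ℂ → ℂ} (hf : DifferentiableOn ℂ f slitPlane) (k : ℕ) {u : ℂ}
    (hu : u ∈ slitPlane) : HasDerivAt (iteratedDeriv k f) (iteratedDeriv (k + 1) f u) u := by
  have h : AnalyticAt ℂ f u := hf.analyticAt (isOpen_slitPlane.mem_nhds hu)
  have h2 : AnalyticAt ℂ (iteratedDeriv k f) u := by
    rw [iteratedDeriv_eq_iterate]
    exact h.iterated_deriv k
  rw [iteratedDeriv_succ]
  exact h2.differentiableAt.hasDerivAt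

theorem update_ne (x : Jet) {i j : ℕ × Fin 2} (h : j ≠ i) (s : ℂ) :
    Function.update x i s j = x j := Function.update_of_ne h s x

theorem dtot_eq_of_pd {F : Jet → ℂ} {x : Jet} (h : ∀ n b, n ≠ 0 → pd (n, b) F x = 0) :
    dtot F x = x (1, 0) * pd (0, 0) F x + x (1, 1) * pd (0, 1) F x := by
  rw [dtot, finsum_eq_single _ 0]
  · simp [Fin.sum_univ_two]
  · intro n hn
    exact Finset.sum_eq_zero fun b _ => by rw [h n b hn, mul_zero]

theorem twoPt_update (φ : ℂ → ℂ) (a b : Fin 2) (x : Jet) {n : ℕ} (hn : n ≠ 0) (c : Fin 2) (s : ℂ) :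
    twoPt φ a b (Function.update x (n, c) s) = twoPt φ a b x := by
  have h0 : ∀ d : Fin 2, Function.update x (n, c) s (0, d) = x (0, d) := fun d =>
    update_ne x (by simp [Ne.symm hn]) s
  simp only [twoPt, h0]

theorem dtot_twoPt {φ : ℂ → ℂ} (hφ : DifferentiableOn ℂ φ slitPlane) (a b : Fin 2) {x : Jet}
    (hx : x (0, 1) ∈ slitPlane) :
    dtot (twoPt φ a b) x
      = !![x (1, 1), x (1, 0); x (1, 0), deriv φ (x (0, 1)) * x (1, 1)] a b := by
  rw [dtot_eq_of_pd fun n c hn => by simp [pd, twoPt_update φ a b x hn]]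
  have hd : HasDerivAt φ (deriv φ (x (0, 1))) (x (0, 1)) :=
    ((hφ.differentiableAt (isOpen_slitPlane.mem_nhds hx))).hasDerivAt
  fin_cases a <;> fin_cases b <;> simp [pd, twoPt, Function.update, mul_comm]

theorem dU_eq {φ : ℂ → ℂ} (hφ : DifferentiableOn ℂ φ slitPlane) {x : Jet}
    (hx : x (0, 1) ∈ slitPlane) :
    dU φ x = !![x (1, 0), x (1, 1); deriv φ (x (0, 1)) * x (1, 1), x (1, 0)] := by
  ext a b
  rw [dU, Matrix.of_apply, dtot_twoPt hφ _ _ hx]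
  fin_cases a <;> fin_cases b <;> rfl

theorem Delta_eq {φ : ℂ → ℂ} (hφ : DifferentiableOn ℂ φ slitPlane) {x : Jet}
    (hx : x (0, 1) ∈ slitPlane) :
    Delta φ x = x (1, 0) ^ 2 - deriv φ (x (0, 1)) * x (1, 1) ^ 2 := by
  rw [Delta, dU_eq hφ hx, Matrix.det_fin_two_of]
  ring

/-- The values of all variables at a point of the jet space. -/
noncomputable def pt (φ ψ : ℂ → ℂ) (x : Jet) : ℕ → ℂ
  | 0 => (x (1, 0) ^ 2 - deriv φ (x (0, 1)) * x (1, 1) ^ 2)⁻¹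
  | 1 => 1 / 5760
  | i + 2 =>
      match i % 4 with
      | 0 => x (i / 4, 0)
      | 1 => x (i / 4, 1)
      | 2 => iteratedDeriv (i / 4) φ (x (0, 1))
      | _ => iteratedDeriv (i / 4) ψ (x (0, 1))

theorem pt_jet (φ ψ : ℂ → ℂ) (x : Jet) (n : ℕ) (a : Fin 2) :
    pt φ ψ x (4 * n + a + 2) = x (n, a) := by
  fin_cases a
  · have h1 : (4 * n + 0) % 4 = 0 := by omega
    have h2 : (4 * n + 0) / 4 = n := by omega
    simp only [Fin.zero_eta, pt, h1, h2]
  · have h1 : (4 * n + 1) % 4 = 1 := by omega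
    have h2 : (4 * n + 1) / 4 = n := by omega
    simp only [Fin.mk_one, pt, h1, h2]

theorem pt_phi (φ ψ : ℂ → ℂ) (x : Jet) (k : ℕ) :
    pt φ ψ x (4 * k + 4) = iteratedDeriv k φ (x (0, 1)) := by
  have h1 : (4 * k + 2) % 4 = 2 := by omega
  have h2 : (4 * k + 2) / 4 = k := by omega
  simp only [pt, h1, h2]

theorem pt_psi (φ ψ : ℂ → ℂ) (x : Jet) (k : ℕ) :
    pt φ ψ x (4 * k + 5) = iteratedDeriv k ψ (x (0, 1)) := by
  have h1 : (4 * k + 3) % 4 = 3 := by omega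
  have h2 : (4 * k + 3) / 4 = k := by omega
  simp only [pt, h1, h2]

variable {φ ψ : ℂ → ℂ}

theorem isPoint_pt (hφ : DifferentiableOn ℂ φ slitPlane) {x : Jet} (hx : x ∈ domain φ) :
    IsPoint (pt φ ψ x) := by
  have h := hx.2
  rw [Delta_eq hφ hx.1] at h
  have h6 : pt φ ψ x 6 = x (1, 0) := pt_jet φ ψ x 1 0
  have h7 : pt φ ψ x 7 = x (1, 1) := pt_jet φ ψ x 1 1
  have h8 : pt φ ψ x 8 = deriv φ (x (0, 1)) := by
    have := pt_phi φ ψ x 1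
    rwa [iteratedDeriv_one] at this
  rw [IsPoint, h6, h7, h8, pt, mul_comm (x (1, 1) ^ 2)]
  exact inv_mul_cancel₀ h

/-- The derivatives of all variables along a curve in the domain. -/
theorem hasDerivAt_pt (hφ : DifferentiableOn ℂ φ slitPlane) (hψ : DifferentiableOn ℂ ψ slitPlane)
    {γ : ℂ → Jet} {ξ : ℕ → Fin 2 → ℂ} {t : ℂ} (hγ : γ t ∈ domain φ)
    (h : ∀ n b, HasDerivAt (fun s => γ s (n, b)) (ξ n b) t) (i : ℕ) :
    HasDerivAt (fun s => pt φ ψ (γ s) i) (extv (pt φ ψ (γ t)) ξ i) t := by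
  have hΔ := hγ.2
  rw [Delta_eq hφ hγ.1] at hΔ
  have hit : ∀ {f : ℂ → ℂ}, DifferentiableOn ℂ f slitPlane → ∀ k,
      HasDerivAt (fun s => iteratedDeriv k f (γ s (0, 1)))
        (iteratedDeriv (k + 1) f (γ t (0, 1)) * ξ 0 1) t := fun hf k =>
    HasDerivAt.comp (h := fun s => γ s (0, 1)) t (hasDerivAt_iteratedDeriv hf k hγ.1) (h 0 1)
  match i with
  | 0 =>
    have h1 := hit hφ 1
    rw [iteratedDeriv_one] at h1
    have h2 := ((((h 1 0).pow 2).sub (h1.mul ((h 1 1).pow 2))).inv hΔ)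
    refine h2.congr_deriv ?_
    have h6 : pt φ ψ (γ t) 6 = γ t (1, 0) := pt_jet φ ψ _ 1 0
    have h7 : pt φ ψ (γ t) 7 = γ t (1, 1) := pt_jet φ ψ _ 1 1
    have h8 : pt φ ψ (γ t) 8 = deriv φ (γ t (0, 1)) := by
      have := pt_phi φ ψ (γ t) 1
      rwa [iteratedDeriv_one] at this
    have h12 : pt φ ψ (γ t) 12 = iteratedDeriv 2 φ (γ t (0, 1)) := pt_phi φ ψ _ 2
    simp only [extv, h6, h7, h8, h12]
    rw [pt]
    simp
    field_simp
    ring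
  | 1 => exact hasDerivAt_const _ _
  | i + 2 =>
    have hj : i % 4 = 0 ∨ i % 4 = 1 ∨ i % 4 = 2 ∨ i % 4 = 3 := by omega
    rcases hj with hj | hj | hj | hj
    · simp only [pt, extv, hj]
      exact h _ _
    · simp only [pt, extv, hj]
      exact h _ _
    · obtain ⟨k, rfl⟩ : ∃ k, i = 4 * k + 2 := ⟨i / 4, by omega⟩
      have := pt_phi φ ψ (γ t) (k + 1)
      simp only [pt_phi φ ψ _ k, extv, hj]
      rw [show 4 * k + 2 + 6 = 4 * (k + 1) + 4 by ring, this, mul_comm]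
      exact hit hφ k
    · obtain ⟨k, rfl⟩ : ∃ k, i = 4 * k + 3 := ⟨i / 4, by omega⟩
      have := pt_psi φ ψ (γ t) (k + 1)
      simp only [pt_psi φ ψ _ k, extv, hj]
      rw [show 4 * k + 3 + 6 = 4 * (k + 1) + 5 by ring, this, mul_comm]
      exact hit hψ k

/-- Both conditions involve only the coordinates of order 0 and 1 and are open. Identities known
only on the domain can therefore be differentiated along curves that are continuous in each
coordinate. -/
theorem eventually_mem_domain (hφ : DifferentiableOn ℂ φ slitPlane) {γ : ℂ → Jet} {t : ℂ}
    (hγ : γ t ∈ domain φ) (h : ∀ n b, ContinuousAt (fun s => γ s (n, b)) t) :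
    ∀ᶠ s in nhds t, γ s ∈ domain φ := by
  have h1 : ∀ᶠ s in nhds t, γ s (0, 1) ∈ slitPlane :=
    (h 0 1).eventually_mem (isOpen_slitPlane.mem_nhds hγ.1)
  have hd : ContinuousAt (deriv φ) (γ t (0, 1)) :=
    ((hφ.analyticAt (isOpen_slitPlane.mem_nhds hγ.1)).deriv).continuousAt
  have h2 : ContinuousAt (fun s => γ s (1, 0) ^ 2 - deriv φ (γ s (0, 1)) * γ s (1, 1) ^ 2) t :=
    ((h 1 0).pow 2).sub ((ContinuousAt.comp (f := fun s => γ s (0, 1)) hd (h 0 1)).mul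
      ((h 1 1).pow 2))
  have h3 := hγ.2
  rw [Delta_eq hφ hγ.1] at h3
  filter_upwards [h1, h2.eventually_ne h3] with s hs1 hs2
  exact ⟨hs1, by rwa [Delta_eq hφ hs1]⟩

theorem hasDerivAt_update (x : Jet) (n : ℕ) (b : Fin 2) (t : ℂ) (m : ℕ) (c : Fin 2) :
    HasDerivAt (fun s => Function.update x (n, b) s (m, c)) (unitVec n b m c) t := by
  by_cases h : (m, c) = (n, b)
  · obtain ⟨rfl, rfl⟩ := Prod.mk.inj h
    simpa [unitVec] using hasDerivAt_id' t
  · have h0 : unitVec n b m c = 0 := by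
      by_cases hm : m = n
      · subst hm
        have : c ≠ b := fun hc => h (by rw [hc])
        simp [unitVec, this]
      · simp [unitVec, Pi.single_eq_of_ne hm]
    simp only [update_ne x h, h0]
    exact hasDerivAt_const _ _

theorem eventually_update_mem_domain (hφ : DifferentiableOn ℂ φ slitPlane) {x : Jet}
    (hx : x ∈ domain φ) (n : ℕ) (b : Fin 2) :
    ∀ᶠ s in nhds (x (n, b)), Function.update x (n, b) s ∈ domain φ :=
  eventually_mem_domain hφ (by rwa [Function.update_eq_self])
    fun m c => (hasDerivAt_update x n b _ m c).continuousAt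

theorem pd_congr (hφ : DifferentiableOn ℂ φ slitPlane) {F G : Jet → ℂ}
    (h : ∀ x ∈ domain φ, F x = G x) {x : Jet} (hx : x ∈ domain φ) (i : ℕ × Fin 2) :
    pd i F x = pd i G x := by
  refine Filter.EventuallyEq.deriv_eq ?_
  filter_upwards [eventually_update_mem_domain hφ hx i.1 i.2] with s hs
  exact h _ hs

theorem eth_congr (hφ : DifferentiableOn ℂ φ slitPlane) {F G : Jet → ℂ}
    (h : ∀ x ∈ domain φ, F x = G x) {x : Jet} (hx : x ∈ domain φ) (k : ℕ) (a : Fin 2) :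
    eth φ k a F x = eth φ k a G x := by
  simp only [eth, pd_congr hφ h hx]

theorem pd_const_mul (c : ℂ) (F : Jet → ℂ) (i : ℕ × Fin 2) (x : Jet) :
    pd i (fun y => c * F y) x = c * pd i F x :=
  deriv_const_mul_field c

theorem eth_const_mul (c : ℂ) (F : Jet → ℂ) (k : ℕ) (a : Fin 2) (x : Jet) :
    eth φ k a (fun y => c * F y) x = c * eth φ k a F x := by
  rw [eth, eth, mul_finsum]
  refine finsum_congr fun n => ?_
  rw [Finset.mul_sum]
  refine Finset.sum_congr rfl fun b _ => ?_
  rw [pd_const_mul]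
  ring

/-- The function `F` is given by the expression `p` on the domain, where the leaves of `p` stand
for the functions `L b`. -/
def Rep (φ ψ : ℂ → ℂ) {β : Type} (L : β → Jet → ℂ) (F : Jet → ℂ) (p : Ex β) : Prop :=
  ∀ x ∈ domain φ, F x = p.ev (pt φ ψ x) fun b => L b x

/-- The derivative of a function given by an expression along a curve. -/
theorem Rep.hasDerivAt (hφ : DifferentiableOn ℂ φ slitPlane) (hψ : DifferentiableOn ℂ ψ slitPlane)
    {β : Type} {L : β → Jet → ℂ} {F : Jet → ℂ} {p : Ex β} (hF : Rep φ ψ L F p)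
    {γ : ℂ → Jet} {ξ : ℕ → Fin 2 → ℂ} {t : ℂ} (hγ : γ t ∈ domain φ)
    (h : ∀ n b, HasDerivAt (fun s => γ s (n, b)) (ξ n b) t)
    (hL : ∀ b s, L b (γ s) = L b (γ t)) :
    HasDerivAt (fun s => F (γ s))
      (p.dev (pt φ ψ (γ t)) (fun b => L b (γ t)) (extv (pt φ ψ (γ t)) ξ)) t := by
  refine (Ex.hasDerivAt_ev (lv := fun b => L b (γ t)) (hasDerivAt_pt hφ hψ hγ h)
    p).congr_of_eventuallyEq ?_
  filter_upwards [eventually_mem_domain hφ hγ fun n b => (h n b).continuousAt] with s hs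
  rw [hF _ hs]
  simp only [hL]

theorem Rep.pd (hφ : DifferentiableOn ℂ φ slitPlane) (hψ : DifferentiableOn ℂ ψ slitPlane)
    {β : Type} {L : β → Jet → ℂ} {F : Jet → ℂ} {p : Ex β} (hF : Rep φ ψ L F p)
    {x : Jet} (hx : x ∈ domain φ) {n : ℕ} {b : Fin 2}
    (hL : ∀ l s, L l (Function.update x (n, b) s) = L l x) :
    pd (n, b) F x = p.dev (pt φ ψ x) (fun l => L l x) (extv (pt φ ψ x) (unitVec n b)) := by
  have h := hF.hasDerivAt hφ hψ (γ := fun s => Function.update x (n, b) s) (t := x (n, b))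
    (by rwa [Function.update_eq_self]) (hasDerivAt_update x n b _) (by simp [hL])
  rw [TwoPrimary.pd, h.deriv, Function.update_eq_self]

theorem Rep.field (hφ : DifferentiableOn ℂ φ slitPlane) (hψ : DifferentiableOn ℂ ψ slitPlane)
    {β : Type} {L : β → Jet → ℂ} {F : Jet → ℂ} {p : Ex β} (hF : Rep φ ψ L F p)
    {x : Jet} (hx : x ∈ domain φ) {c : ℕ → Fin 2 → ℂ}
    (hL : ∀ n b, c n b ≠ 0 → ∀ l s, L l (Function.update x (n, b) s) = L l x) :
    ∑ᶠ n : ℕ, ∑ b, c n b * TwoPrimary.pd (n, b) F x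
      = p.dev (pt φ ψ x) (fun l => L l x) (extv (pt φ ψ x) c) := by
  rw [← finsum_dev]
  refine finsum_congr fun n => Finset.sum_congr rfl fun b _ => ?_
  by_cases h : c n b = 0
  · rw [h, zero_mul, zero_mul]
  · rw [hF.pd hφ hψ hx (hL n b h)]

/-- The value of the (nonexistent) leaves of an expression without leaves. -/
abbrev noLeaf (b : Empty) (_ : Jet) : ℂ := b.elim

/-- The function `F` is given by the expression `p` on the domain. -/
abbrev Rep0 (φ ψ : ℂ → ℂ) (F : Jet → ℂ) (p : Ex Empty) : Prop := Rep φ ψ noLeaf F p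

/-- The bridge between analysis and algebra. Leaves must be constant in the directions where the
field has a nonzero component, because `der` treats them as constants. -/
theorem Rep.field_ext (hφ : DifferentiableOn ℂ φ slitPlane)
    (hψ : DifferentiableOn ℂ ψ slitPlane)
    {β : Type} {L : β → Jet → ℂ} {F : Jet → ℂ} {p : Ex β} (hF : Rep φ ψ L F p)
    {c : ℕ → Fin 2 → Jet → ℂ} {ξ : ℕ → Fin 2 → Ex Empty} (hc : ∀ n b, Rep0 φ ψ (c n b) (ξ n b))
    (hL : ∀ x ∈ domain φ, ∀ n b, c n b x ≠ 0 → ∀ l s, L l (Function.update x (n, b) s) = L l x) :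
    Rep φ ψ L (fun x => ∑ᶠ n : ℕ, ∑ b, c n b x * TwoPrimary.pd (n, b) F x) (der (ext ξ) p) := by
  intro x hx
  have hv := isPoint_pt (ψ := ψ) hφ hx
  change ∑ᶠ n : ℕ, ∑ b, c n b x * TwoPrimary.pd (n, b) F x = _
  rw [hF.field hφ hψ hx (hL x hx), ev_der hv _ fun b => noLeaf b x]
  congr 1
  funext i
  rw [ev_ext hv]
  congr 1
  funext n b
  exact hc n b x hx

theorem rep_jet (n : ℕ) (a : Fin 2) :
    Rep0 φ ψ (fun x => x (n, a)) (jet n a) := fun x _ => by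
  rw [jet, ev_x, pt_jet]

theorem Rep.dtot (hφ : DifferentiableOn ℂ φ slitPlane) (hψ : DifferentiableOn ℂ ψ slitPlane)
    {F : Jet → ℂ} {p : Ex Empty} (hF : Rep0 φ ψ F p) : Rep0 φ ψ (TwoPrimary.dtot F) (dtotP p) :=
  hF.field_ext hφ hψ (c := fun n b x => x (n + 1, b)) (fun _ _ => rep_jet _ _)
    fun _ _ _ _ _ l => l.elim

theorem rep_dUP (hφ : DifferentiableOn ℂ φ slitPlane) (a b : Fin 2) :
    Rep0 φ ψ (fun x => dU φ x a b) (dUP a b) := fun x hx => by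
  have hv := isPoint_pt (ψ := ψ) hφ hx
  change dU φ x a b = _
  rw [dU_eq hφ hx.1]
  fin_cases a <;> fin_cases b <;>
    simp [dUP, ev_mul hv, jet, phi, ev_x]
  · exact (pt_jet φ ψ x 1 0).symm
  · exact (pt_jet φ ψ x 1 1).symm
  · have h8 := pt_phi φ ψ x 1
    rw [iteratedDeriv_one] at h8
    exact congrArg₂ _ h8.symm (pt_jet φ ψ x 1 1).symm
  · exact (pt_jet φ ψ x 1 0).symm

theorem rep_faaP (hφ : DifferentiableOn ℂ φ slitPlane) (hψ : DifferentiableOn ℂ ψ slitPlane)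
    (n k : ℕ) (a b : Fin 2) : Rep0 φ ψ (fun x => faa φ n k x a b) (faaP n k a b) := by
  induction n generalizing k a b with
  | zero =>
    cases k with
    | zero => exact rep_dUP hφ a b
    | succ k => exact fun x hx => rfl
  | succ n ih =>
    cases k with
    | zero => exact (ih 0 a b).dtot hφ hψ
    | succ k =>
      intro x hx
      have hv := isPoint_pt (ψ := ψ) hφ hx
      simp only [faa, faaP, ev_add, ev_sum, ev_mul hv, Matrix.add_apply, Matrix.of_apply,
        Matrix.mul_apply]
      rw [(ih (k + 1) a b).dtot hφ hψ x hx]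
      congr 1
      refine Finset.sum_congr rfl fun c _ => ?_
      rw [← ih k c b x hx, ← rep_dUP hφ a c x hx]

/-- Each of the n factors ∂ + z ∂U contributes at most one power of z. Thus ð_{k,a} has no component
along u^b_n with n < k. -/
theorem faa_of_lt (φ : ℂ → ℂ) {n k : ℕ} (h : n < k) : faa φ n k = 0 := by
  induction n generalizing k with
  | zero => cases k with
    | zero => omega
    | succ k => rfl
  | succ n ih =>
    obtain ⟨k, rfl⟩ : ∃ j, k = j + 1 := ⟨k - 1, by omega⟩
    have h0 : ∀ x, dtot (fun _ => 0) x = 0 := fun x => by simp [dtot, pd]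
    funext x
    ext a b
    simp [faa, ih (show n < k by omega), ih (show n < k + 1 by omega), h0]

theorem faa_self (φ : ℂ → ℂ) (n : ℕ) (x : Jet) : faa φ n n x = dU φ x ^ (n + 1) := by
  induction n with
  | zero => simp [faa]
  | succ n ih =>
    have h0 : ∀ x, dtot (fun _ => 0) x = 0 := fun x => by simp [dtot, pd]
    ext a b
    simp [faa, faa_of_lt φ (Nat.lt_succ_self n), h0, ih, ← pow_succ']

theorem Rep.eth (hφ : DifferentiableOn ℂ φ slitPlane) (hψ : DifferentiableOn ℂ ψ slitPlane)
    {F : Jet → ℂ} {p : Ex Empty} (hF : Rep0 φ ψ F p) (k : ℕ) (a : Fin 2) :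
    Rep0 φ ψ (TwoPrimary.eth φ k a F) (ethP k a p) :=
  hF.field_ext hφ hψ (c := fun n b x => faa φ n k x a b) (fun n b => rep_faaP hφ hψ n k a b)
    fun _ _ _ _ _ l => l.elim

/-- Functions of `(v, u)` as functions on the jet space. -/
abbrev baseFn (g : ℂ × ℂ → ℂ) (x : Jet) : ℂ := g (x (0, 0), x (0, 1))

theorem baseFn_update (g : ℂ × ℂ → ℂ) (x : Jet) {n : ℕ} (hn : n ≠ 0) (b : Fin 2) (s : ℂ) :
    baseFn g (Function.update x (n, b) s) = baseFn g x := by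
  simp only [baseFn]
  rw [update_ne x (by simp [Ne.symm hn]), update_ne x (by simp [Ne.symm hn])]

/-- For k ≥ 1 the field does not differentiate in v and u, so arbitrary functions of (v, u) are
admitted as leaves. -/
theorem Rep.eth_base (hφ : DifferentiableOn ℂ φ slitPlane)
    (hψ : DifferentiableOn ℂ ψ slitPlane)
    {F : Jet → ℂ} {p : Ex (ℂ × ℂ → ℂ)} (hF : Rep φ ψ baseFn F p) {k : ℕ} (hk : k ≠ 0)
    (a : Fin 2) : Rep φ ψ baseFn (TwoPrimary.eth φ k a F) (ethP k a p) :=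
  hF.field_ext hφ hψ (c := fun n b x => faa φ n k x a b) (fun n b => rep_faaP hφ hψ n k a b)
    fun x _ n b h l s => baseFn_update l x (by
      rintro rfl
      exact h (by simp [faa_of_lt φ (Nat.pos_of_ne_zero hk)])) b s

end TwoPrimary

/-! ### Expressions for the correlators, the right hand sides and F_{2,0} + F_{2,1}. -/

namespace TwoPrimary

open Ex

variable {φ ψ : ℂ → ℂ}

theorem rep_twoPt (a b : Fin 2) : Rep0 φ ψ (twoPt φ a b) (twoPtP a b) := fun x _ => by
  have h0 : pt φ ψ x 4 = φ (x (0, 1)) := by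
    have := pt_phi φ ψ x 0
    rwa [iteratedDeriv_zero] at this
  fin_cases a <;> fin_cases b <;> simp [twoPt, twoPtP, jet, phi, ev_x, h0]
  · exact (pt_jet φ ψ x 0 1).symm
  · exact (pt_jet φ ψ x 0 0).symm
  · exact (pt_jet φ ψ x 0 0).symm

theorem rep_corr0 (hφ : DifferentiableOn ℂ φ slitPlane) (hψ : DifferentiableOn ℂ ψ slitPlane)
    (a b : Fin 2) (l : List (Fin 2)) : Rep0 φ ψ (corr0 φ a b l) (corr0P a b l) := by
  induction l with
  | nil => exact rep_twoPt a b
  | cons c l ih => exact ih.eth hφ hψ 0 c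

theorem rep_psi (hφ : DifferentiableOn ℂ φ slitPlane) (hψ : DifferentiableOn ℂ ψ slitPlane)
    (l : List (Fin 2)) :
    Rep0 φ ψ (l.foldr (d0 φ) (psiFn ψ)) (l.foldr (ethP 0) (psi 0)) := by
  induction l with
  | nil =>
    intro x _
    have := pt_psi φ ψ x 0
    rw [iteratedDeriv_zero] at this
    simp only [List.foldr_nil, psi, ev_x, this, psiFn]
  | cons c l ih => exact ih.eth hφ hψ 0 c

theorem rep_Delta (hφ : DifferentiableOn ℂ φ slitPlane) :
    Rep0 φ ψ (Delta φ) DeltaP := fun x hx => by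
  have hv := isPoint_pt (ψ := ψ) hφ hx
  have h8 := pt_phi φ ψ x 1
  rw [iteratedDeriv_one] at h8
  have h6 := pt_jet φ ψ x 1 0
  have h7 := pt_jet φ ψ x 1 1
  rw [Delta_eq hφ hx.1]
  simp only [DeltaP, ev_sub hv, ev_mul hv, jet, phi, ev_x, h6, h7, h8]
  ring

theorem pt_zero (hφ : DifferentiableOn ℂ φ slitPlane) {x : Jet} (hx : x ∈ domain φ) :
    pt φ ψ x 0 = (Delta φ x)⁻¹ := by
  rw [Delta_eq hφ hx.1, pt]

/-- The factor 24 clears the denominator of F_1. The remaining denominators divide 5760 = 10 · 24²,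
whose inverse is the variable 1. -/
theorem rep_corr1 (hφ : DifferentiableOn ℂ φ slitPlane) (hψ : DifferentiableOn ℂ ψ slitPlane)
    (a : Fin 2) (l : List (Fin 2)) :
    Rep0 φ ψ (fun x => 24 * corr1 φ ψ a l x) (corr1P a l) := by
  induction l with
  | nil =>
    intro x hx
    have hv := isPoint_pt (ψ := ψ) hφ hx
    have h1 : eth φ 0 a (psiFn ψ) x = _ := (rep_psi hφ hψ []).eth hφ hψ 0 a x hx
    simp only [List.foldr_nil] at h1
    simp only [corr1P, List.foldr_nil, ev_add, ev_mul hv, ev_smul hv, ev_x, pt_zero hφ hx,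
      ← (rep_Delta hφ).eth hφ hψ 0 a x hx, ← h1, corr1, onePt1, d0]
    push_cast
    ring
  | cons c l ih =>
    intro x hx
    change 24 * eth φ 0 c (corr1 φ ψ a l) x = _
    rw [← eth_const_mul]
    exact ih.eth hφ hψ 0 c x hx

theorem corr1_eq (hφ : DifferentiableOn ℂ φ slitPlane) (hψ : DifferentiableOn ℂ ψ slitPlane)
    (a : Fin 2) (l : List (Fin 2)) {x : Jet} (hx : x ∈ domain φ) :
    corr1 φ ψ a l x = (corr1P a l).ev (pt φ ψ x) (fun b => noLeaf b x) / 24 := by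
  rw [← rep_corr1 hφ hψ a l x hx]
  ring

theorem rep_R (hφ : DifferentiableOn ℂ φ slitPlane) (hψ : DifferentiableOn ℂ ψ slitPlane)
    (k : ℕ) (a : Fin 2) : Rep0 φ ψ (R φ ψ k a) (RP k a) := by
  intro x hx
  have hv := isPoint_pt (ψ := ψ) hφ hx
  have h1 : pt φ ψ x 1 = 1 / 5760 := rfl
  match k with
  | 2 =>
    simp only [R, RP, ev_mul hv, ev_sum, ev_add, ev_sub hv, ev_smul hv, ev_x, h1,
      rep_corr0 hφ hψ _ _ _ x hx, corr1_eq hφ hψ _ _ hx, Finset.mul_sum]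
    refine Finset.sum_congr rfl fun b _ => Finset.sum_congr rfl fun c _ => ?_
    push_cast
    ring
  | 3 =>
    simp only [R, RP, ev_mul hv, ev_sum, ev_add, ev_smul hv, ev_x, h1,
      rep_corr0 hφ hψ _ _ _ x hx, corr1_eq hφ hψ _ _ hx, Finset.mul_sum]
    refine Finset.sum_congr rfl fun b _ => Finset.sum_congr rfl fun c _ =>
      Finset.sum_congr rfl fun d _ => ?_
    push_cast
    ring
  | 4 =>
    simp only [R, RP, ev_mul hv, ev_sum, ev_smul hv, ev_x, h1,
      rep_corr0 hφ hψ _ _ _ x hx, Finset.mul_sum]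
    refine Finset.sum_congr rfl fun b _ => Finset.sum_congr rfl fun c _ =>
      Finset.sum_congr rfl fun d _ => Finset.sum_congr rfl fun e _ => ?_
    push_cast
    ring
  | 0 => rfl
  | 1 => rfl
  | _ + 5 => rfl

theorem rep_R11 (hφ : DifferentiableOn ℂ φ slitPlane) (hψ : DifferentiableOn ℂ ψ slitPlane)
    (a b : Fin 2) : Rep0 φ ψ (R11 φ ψ a b) (R11P a b) := by
  intro x hx
  have hv := isPoint_pt (ψ := ψ) hφ hx
  have h1 : pt φ ψ x 1 = 1 / 5760 := rfl
  simp only [R11, R11P, ev_mul hv, ev_sum, ev_add, ev_sub hv, ev_smul hv, ev_x, h1,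
    rep_corr0 hφ hψ _ _ _ x hx, corr1_eq hφ hψ _ _ hx, Finset.mul_sum]
  refine Finset.sum_congr rfl fun b _ => Finset.sum_congr rfl fun c _ => ?_
  push_cast
  ring

theorem Rep.eth11 (hφ : DifferentiableOn ℂ φ slitPlane) (hψ : DifferentiableOn ℂ ψ slitPlane)
    {F : Jet → ℂ} {p : Ex Empty} (hF : Rep0 φ ψ F p) (a b : Fin 2) :
    Rep0 φ ψ (TwoPrimary.eth11 φ a b F) (eth11P a b p) := by
  intro x hx
  have hv := isPoint_pt (ψ := ψ) hφ hx
  simp only [TwoPrimary.eth11, eth11P, ev_sub hv, ev_smul hv, ev_sum, ev_mul hv,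
    ev_lift _ fun b => noLeaf b x, ← rep_corr0 hφ hψ _ _ _ x hx, ← hF.eth hφ hψ _ _ x hx,
    ← (hF.eth hφ hψ 1 b).eth hφ hψ 1 a x hx]
  push_cast
  rfl

theorem rep_vert (hφ : DifferentiableOn ℂ φ slitPlane) (hψ : DifferentiableOn ℂ ψ slitPlane)
    (n : ℕ) (a b : Fin 2) (l : List (Fin 2)) : Rep0 φ ψ (vert φ n a b l) (vertP n a b l) := by
  induction n with
  | zero => exact rep_corr0 hφ hψ a b l
  | succ n ih =>
    rw [vert, vertP, Function.iterate_succ_apply', Function.iterate_succ_apply']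
    exact ih.dtot hφ hψ

theorem rep_psiVert (hφ : DifferentiableOn ℂ φ slitPlane) (hψ : DifferentiableOn ℂ ψ slitPlane)
    (n : ℕ) (l : List (Fin 2)) : Rep0 φ ψ (psiVert φ ψ n l) (psiVertP n l) := by
  induction n with
  | zero => exact rep_psi hφ hψ l
  | succ n ih =>
    rw [psiVert, psiVertP, Function.iterate_succ_apply', Function.iterate_succ_apply']
    exact ih.dtot hφ hψ

theorem dU_inv_eq (hφ : DifferentiableOn ℂ φ slitPlane) {x : Jet} (hx : x ∈ domain φ) :
    (dU φ x)⁻¹ = !![(Delta φ x)⁻¹ * x (1, 0), -((Delta φ x)⁻¹ * x (1, 1));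
      -((Delta φ x)⁻¹ * (deriv φ (x (0, 1)) * x (1, 1))), (Delta φ x)⁻¹ * x (1, 0)] := by
  rw [Matrix.inv_def, ← Delta, Ring.inverse_eq_inv', dU_eq hφ hx.1, Matrix.adjugate_fin_two_of]
  ext a b
  fin_cases a <;> fin_cases b <;> simp

theorem rep_prop (hφ : DifferentiableOn ℂ φ slitPlane) (a b : Fin 2) :
    Rep0 φ ψ (prop φ a b) (propP a b) := fun x hx => by
  have hv := isPoint_pt (ψ := ψ) hφ hx
  have h8 := pt_phi φ ψ x 1
  rw [iteratedDeriv_one] at h8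
  have h6 := pt_jet φ ψ x 1 0
  have h7 := pt_jet φ ψ x 1 1
  simp only [Fin.val_zero, Fin.val_one] at h6 h7
  rw [prop, dU_inv_eq hφ hx, propP]
  generalize up a = c
  fin_cases c <;> fin_cases b <;>
    simp [ev_mul hv, ev_smul hv, ev_x, jet, phi, pt_zero hφ hx, h6, h7, h8]

theorem rep_F20 (hφ : DifferentiableOn ℂ φ slitPlane) (hψ : DifferentiableOn ℂ ψ slitPlane) :
    Rep0 φ ψ (F20 φ) F20P := by
  intro x hx
  have hv := isPoint_pt (ψ := ψ) hφ hx
  have h1 : pt φ ψ x 1 = 1 / 5760 := rfl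
  simp only [F20, F20P, ev_mul hv, ev_sum, ev_add, ev_sub hv, ev_smul hv, ev_x, h1,
    rep_vert hφ hψ _ _ _ _ x hx, rep_prop (ψ := ψ) hφ _ _ x hx]
  push_cast
  ring

theorem rep_F21 (hφ : DifferentiableOn ℂ φ slitPlane) (hψ : DifferentiableOn ℂ ψ slitPlane) :
    Rep0 φ ψ (F21 φ ψ) F21P := by
  intro x hx
  have hv := isPoint_pt (ψ := ψ) hφ hx
  have h1 : pt φ ψ x 1 = 1 / 5760 := rfl
  have h7 : pt φ ψ x (4 * 1 + ((1 : Fin 2) : ℕ) + 2) = x (1, 1) := pt_jet φ ψ x 1 1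
  simp only [F21, F21P, ev_mul hv, ev_sum, ev_add, ev_sub hv, ev_smul hv, ev_x, h1,
    rep_vert hφ hψ _ _ _ _ x hx, rep_prop (ψ := ψ) hφ _ _ x hx, rep_psiVert hφ hψ _ _ x hx]
  rw [mul_add, mul_add, mul_add, mul_add]
  refine congrArg₂ _ (congrArg₂ _ (congrArg₂ _ (congrArg₂ _ ?_ ?_) ?_) ?_) ?_
  · simp only [Finset.mul_sum]
    refine Finset.sum_congr rfl fun a _ => Finset.sum_congr rfl fun b _ => ?_
    push_cast
    ring
  · simp only [Finset.mul_sum]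
    refine Finset.sum_congr rfl fun a _ => Finset.sum_congr rfl fun b _ =>
      Finset.sum_congr rfl fun c _ => Finset.sum_congr rfl fun d _ => ?_
    push_cast
    ring
  · simp only [Finset.mul_sum]
    refine Finset.sum_congr rfl fun a _ => Finset.sum_congr rfl fun b _ =>
      Finset.sum_congr rfl fun c _ => Finset.sum_congr rfl fun d _ => ?_
    push_cast
    ring
  · simp only [Finset.mul_sum]
    refine Finset.sum_congr rfl fun a _ => Finset.sum_congr rfl fun b _ =>
      Finset.sum_congr rfl fun c _ => Finset.sum_congr rfl fun d _ =>
      Finset.sum_congr rfl fun e _ => Finset.sum_congr rfl fun f _ => ?_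
    push_cast
    ring
  · simp only [jet, phi, psi, ev_x, h7, pt_phi, pt_psi, pt_zero hφ hx]
    push_cast
    ring

theorem rep_F2 (hφ : DifferentiableOn ℂ φ slitPlane) (hψ : DifferentiableOn ℂ ψ slitPlane) :
    Rep0 φ ψ (F20 φ + F21 φ ψ) (F20P + F21P) := fun x hx => by
  rw [ev_add, Pi.add_apply, rep_F20 hφ hψ x hx, rep_F21 hφ hψ x hx]

theorem rep_genusOne (hφ : DifferentiableOn ℂ φ slitPlane) :
    Rep0 φ ψ (fun x => 24 * genusOne φ ψ (x (0, 1))) genusOneP := fun x hx => by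
  have hv := isPoint_pt (ψ := ψ) hφ hx
  simp only [genusOneP, ev_sub hv, ev_add, ev_smul hv, ev_mul hv, phi, psi, ev_x, pt_phi, pt_psi,
    genusOne, iteratedDeriv_one]
  push_cast
  ring

/-- The equation genusOne = 0 holds on an open set, so it may be differentiated in u. -/
theorem ev_genusOneP' (hφ : DifferentiableOn ℂ φ slitPlane) (hψ : DifferentiableOn ℂ ψ slitPlane)
    (h : ∀ u ∈ slitPlane, genusOne φ ψ u = 0) {x : Jet} (hx : x ∈ domain φ) :
    genusOneP'.ev (pt φ ψ x) (fun b => noLeaf b x) = 0 := by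
  have hv := isPoint_pt (ψ := ψ) hφ hx
  have hF := fun k => hasDerivAt_iteratedDeriv hφ k hx.1
  have hG := fun k => hasDerivAt_iteratedDeriv hψ k hx.1
  have h1 := (((hF 3).const_mul (1 / 24)).add ((hF 2).mul (hG 1))).sub
    (((hF 1).const_mul 2).mul (hG 2))
  have h2 : HasDerivAt (genusOne φ ψ) 0 (x (0, 1)) :=
    (hasDerivAt_const _ (0 : ℂ)).congr_of_eventuallyEq (by
      filter_upwards [isOpen_slitPlane.mem_nhds hx.1] with u hu
      exact h u hu)
  have h3 := h2.unique (h1.congr_of_eventuallyEq (Filter.Eventually.of_forall fun u => by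
    simp [genusOne, iteratedDeriv_one]))
  simp only [genusOneP', ev_sub hv, ev_add, ev_smul hv, ev_mul hv, phi, psi, ev_x, pt_phi, pt_psi,
    iteratedDeriv_one]
  push_cast
  norm_num at h3
  linear_combination (-24) * h3

theorem ev_elim (hφ : DifferentiableOn ℂ φ slitPlane) (hψ : DifferentiableOn ℂ ψ slitPlane)
    (h : ∀ u ∈ slitPlane, genusOne φ ψ u = 0) {x : Jet} (hx : x ∈ domain φ) (p : Ex Empty) :
    (elim p).ev (pt φ ψ x) (fun b => noLeaf b x) = p.ev (pt φ ψ x) fun b => noLeaf b x := by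
  have hv := isPoint_pt (ψ := ψ) hφ hx
  have h0 : genusOneP.ev (pt φ ψ x) (fun b => noLeaf b x) = 0 := by
    rw [← rep_genusOne hφ x hx]
    simp [h _ hx.1]
  simp only [elim, ev_sub hv, ev_mul hv, h0, ev_genusOneP' hφ hψ h hx, mul_zero, sub_zero]

end TwoPrimary

/-! ### The polynomial identities. -/

namespace TwoPrimary

open Ex

/-- The function `F_{2,0} + F_{2,1}`. -/
def F2P : Ex Empty := F20P + F21P

/-- The third power of the inverse of `∂U`. -/
def invCubeP (a b : Fin 2) : Ex Empty :=
  sum fun c => sum fun d => propP (up a) c * propP (up c) d * propP (up d) b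

/-- A solution of the first recursion, which does not depend on `genusOne = 0`. -/
def T2P : Ex Empty :=
  F2P + sum fun b => jet 2 b * sum fun a => invCubeP b a * (RP 2 a - ethP 2 a F2P)

/-- A test for normal forms. -/
def Ex.isNF {β : Type} : Ex β → Bool
  | nf _ => true
  | _ => false

/-- All monomials contain one of the variables that vanish on the small phase space. -/
def Terms.small : Terms → Bool
  | nil => true
  | cons m _ p =>
      cond ([7, 10, 11, 14, 15, 18, 19].all fun i => Nat.beq (m / 256 ^ i % 256) 0) false (small p)

/-- The expression is a normal form that vanishes on the small phase space. -/
def Ex.isSmall {β : Type} : Ex β → Bool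
  | nf l => l.small
  | _ => false

/-- No `elim` is needed: the identity holds with the derivatives of φ and ψ as independent
variables. The constant is 32 = (2/15) · 5760/24. -/
theorem isZero_commutator : isZero (eth11P 0 0 (RP 2 0) - ethP 2 0 (R11P 0 0)
    - (32 : ℤ) • (x 1 * jet 1 1 * jet 1 1 * jet 1 1
      * ((4 : ℤ) • (jet 1 0 * jet 1 0) + jet 1 1 * jet 1 1 * phi 1) * genusOneP)) = true := by
  decide +kernel

/-- The condition genusOne = 0 enters only for k = 2 and for ð_{1,1,a,b}. The equations for k = 3, 4
and the vanishing on the small phase space hold identically. -/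
theorem isZero_F2P :
    (F2P.isNF && F2P.isSmall) = true ∧ (∀ a, (ethP 1 a F2P).isSmall = true)
    ∧ (∀ a, isZero (elim (ethP 2 a F2P - RP 2 a)) = true)
    ∧ (∀ a, isZero (ethP 3 a F2P - RP 3 a) = true)
    ∧ (∀ a, isZero (ethP 4 a F2P - RP 4 a) = true)
    ∧ (∀ a b, isZero (elim (eth11P a b F2P - R11P a b)) = true) := by
  decide +kernel

/-- Since ð_{2,a}u^b_2 = (∂U³)_a^b, the term of `T2P` that contains u^b_2 with the factor (∂U)⁻³
absorbs the error of `F2P` in the equations for k = 2. The last identity exhibits the obstruction to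
(TRR22). -/
theorem isZero_T2P :
    T2P.isNF = true
    ∧ (∀ a, isZero (ethP 2 a T2P - RP 2 a) = true)
    ∧ (∀ a, isZero (ethP 3 a T2P - RP 3 a) = true)
    ∧ (∀ a, isZero (ethP 4 a T2P - RP 4 a) = true)
    ∧ isZero (ethP 2 0 (R11P 0 0 - eth11P 0 0 T2P)
      + (32 : ℤ) • (x 1 * jet 1 1 * jet 1 1 * jet 1 1
      * ((4 : ℤ) • (jet 1 0 * jet 1 0) + jet 1 1 * jet 1 1 * phi 1) * genusOneP)) = true := by
  decide +kernel

/-- The matrices ∂U and ∂_{0,a}U are polynomials in ∂U/∂u, so they commute, and ð_{1,a}∂U = ∂U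
∂_{0,a}U. Hence ð_{1,a}(∂U)⁻³ = -3 (∂U)⁻³ ∂_{0,a}U, where ∂_{0,a}U has the entries ⟨⟨O_a O_b
O^d⟩⟩_0. -/
theorem isZero_invCubeP : ∀ a c d, isZero (ethP 1 a (invCubeP c d)
    + (3 : ℤ) • sum fun b => invCubeP c b * corr0P a b [up d]) = true := by
  decide +kernel

end TwoPrimary

namespace TwoPrimary

open Ex

variable {φ ψ : ℂ → ℂ}

/-! ### Admissible functions -/

/-- The coefficients of a polynomial are holomorphic. -/
def HolCoeff (P : MvPolynomial (ℕ × Fin 2) (ℂ × ℂ → ℂ)) : Prop :=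
  ∀ s, DifferentiableOn ℂ (P.coeff s) {w : ℂ × ℂ | w.2 ∈ slitPlane}

theorem HolCoeff.add {P Q : MvPolynomial (ℕ × Fin 2) (ℂ × ℂ → ℂ)} (hP : HolCoeff P)
    (hQ : HolCoeff Q) : HolCoeff (P + Q) := fun s => by
  rw [MvPolynomial.coeff_add]
  exact (hP s).add (hQ s)

theorem HolCoeff.mul {P Q : MvPolynomial (ℕ × Fin 2) (ℂ × ℂ → ℂ)} (hP : HolCoeff P)
    (hQ : HolCoeff Q) : HolCoeff (P * Q) := fun s => by
  rw [MvPolynomial.coeff_mul]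
  exact DifferentiableOn.sum fun i _ => (hP i.1).mul (hQ i.2)

theorem holCoeff_C {g : ℂ × ℂ → ℂ} (hg : DifferentiableOn ℂ g {w : ℂ × ℂ | w.2 ∈ slitPlane}) :
    HolCoeff (MvPolynomial.C g) := fun s => by
  rw [MvPolynomial.coeff_C]
  split
  · exact hg
  · exact differentiableOn_const (0 : ℂ)

theorem holCoeff_X (i : ℕ × Fin 2) : HolCoeff (MvPolynomial.X i) := fun s => by
  rw [MvPolynomial.coeff_X]
  split
  · exact differentiableOn_const (1 : ℂ)
  · exact differentiableOn_const (0 : ℂ)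

theorem HolCoeff.pow {P : MvPolynomial (ℕ × Fin 2) (ℂ × ℂ → ℂ)} (hP : HolCoeff P) (n : ℕ) :
    HolCoeff (P ^ n) := by
  induction n with
  | zero =>
    rw [pow_zero, ← MvPolynomial.C_1]
    exact holCoeff_C (differentiableOn_const (1 : ℂ))
  | succ n ih =>
    rw [pow_succ]
    exact ih.mul hP

/-- The value of a polynomial at a point of the jet space. -/
noncomputable def polyVal (x : Jet) (P : MvPolynomial (ℕ × Fin 2) (ℂ × ℂ → ℂ)) : ℂ :=
  P.eval₂ (Pi.evalRingHom (fun _ : ℂ × ℂ => ℂ) (x (0, 0), x (0, 1))) fun i => x (i.1 + 1, i.2)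

theorem polyVal_add (x : Jet) (P Q : MvPolynomial (ℕ × Fin 2) (ℂ × ℂ → ℂ)) :
    polyVal x (P + Q) = polyVal x P + polyVal x Q := MvPolynomial.eval₂_add _ _

theorem polyVal_mul (x : Jet) (P Q : MvPolynomial (ℕ × Fin 2) (ℂ × ℂ → ℂ)) :
    polyVal x (P * Q) = polyVal x P * polyVal x Q := MvPolynomial.eval₂_mul _ _

theorem polyVal_pow (x : Jet) (P : MvPolynomial (ℕ × Fin 2) (ℂ × ℂ → ℂ)) (n : ℕ) :
    polyVal x (P ^ n) = polyVal x P ^ n := MvPolynomial.eval₂_pow _ _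

theorem polyVal_C (x : Jet) (g : ℂ × ℂ → ℂ) :
    polyVal x (MvPolynomial.C g) = g (x (0, 0), x (0, 1)) := MvPolynomial.eval₂_C _ _ _

theorem polyVal_X (x : Jet) (i : ℕ × Fin 2) :
    polyVal x (MvPolynomial.X i) = x (i.1 + 1, i.2) := MvPolynomial.eval₂_X _ _ _

theorem admissible_iff {F : Jet → ℂ} : Admissible φ F ↔ ∃ m P, HolCoeff P ∧
    ∀ x ∈ domain φ, F x = (Delta φ x ^ m)⁻¹ * polyVal x P := Iff.rfl

theorem admissible_poly {F : Jet → ℂ} (P : MvPolynomial (ℕ × Fin 2) (ℂ × ℂ → ℂ))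
    (hP : HolCoeff P) (h : ∀ x ∈ domain φ, F x = polyVal x P) : Admissible φ F :=
  ⟨0, P, hP, fun x hx => by rw [h x hx, pow_zero, inv_one, one_mul]; rfl⟩

theorem admissible_base {F : Jet → ℂ} (g : ℂ × ℂ → ℂ)
    (hg : DifferentiableOn ℂ g {w : ℂ × ℂ | w.2 ∈ slitPlane})
    (h : ∀ x ∈ domain φ, F x = g (x (0, 0), x (0, 1))) : Admissible φ F :=
  admissible_poly _ (holCoeff_C hg) fun x hx => by rw [h x hx, polyVal_C]

theorem admissible_const (c : ℂ) : Admissible φ fun _ => c :=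
  admissible_base (fun _ => c) (differentiableOn_const c) fun _ _ => rfl

theorem Admissible.congr {F G : Jet → ℂ} (hF : Admissible φ F)
    (h : ∀ x ∈ domain φ, G x = F x) : Admissible φ G := by
  obtain ⟨m, P, hP, hF⟩ := hF
  exact ⟨m, P, hP, fun x hx => by rw [h x hx, hF x hx]⟩

theorem Admissible.mul {F G : Jet → ℂ} (hF : Admissible φ F) (hG : Admissible φ G) :
    Admissible φ fun x => F x * G x := by
  obtain ⟨m, P, hP, hF⟩ := admissible_iff.1 hF
  obtain ⟨n, Q, hQ, hG⟩ := admissible_iff.1 hG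
  refine admissible_iff.2 ⟨m + n, P * Q, hP.mul hQ, fun x hx => ?_⟩
  simp only [hF x hx, hG x hx]
  rw [polyVal_mul, pow_add, mul_inv]
  ring

theorem differentiableOn_snd {f : ℂ → ℂ} (hf : DifferentiableOn ℂ f slitPlane) :
    DifferentiableOn ℂ (fun w : ℂ × ℂ => f w.2) {w : ℂ × ℂ | w.2 ∈ slitPlane} :=
  hf.comp differentiable_snd.differentiableOn fun _ hw => hw

theorem differentiableOn_iteratedDeriv {f : ℂ → ℂ} (hf : DifferentiableOn ℂ f slitPlane) (k : ℕ) :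
    DifferentiableOn ℂ (iteratedDeriv k f) slitPlane := fun _ hu =>
  (hasDerivAt_iteratedDeriv hf k hu).differentiableAt.differentiableWithinAt

/-- The determinant `Δ` as a polynomial. -/
noncomputable def DeltaPoly (φ : ℂ → ℂ) : MvPolynomial (ℕ × Fin 2) (ℂ × ℂ → ℂ) :=
  MvPolynomial.X (0, 0) ^ 2 + MvPolynomial.C (fun _ => -1)
    * (MvPolynomial.C (fun w => iteratedDeriv 1 φ w.2) * MvPolynomial.X (0, 1) ^ 2)

theorem holCoeff_DeltaPoly (hφ : DifferentiableOn ℂ φ slitPlane) : HolCoeff (DeltaPoly φ) :=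
  ((holCoeff_X _).pow 2).add ((holCoeff_C (differentiableOn_const (-1))).mul
    ((holCoeff_C (differentiableOn_snd (differentiableOn_iteratedDeriv hφ 1))).mul
      ((holCoeff_X _).pow 2)))

theorem Delta_eq_polyVal (hφ : DifferentiableOn ℂ φ slitPlane) {x : Jet} (hx : x ∈ domain φ) :
    Delta φ x = polyVal x (DeltaPoly φ) := by
  rw [Delta_eq hφ hx.1, DeltaPoly, polyVal_add, polyVal_mul, polyVal_mul, polyVal_C, polyVal_C,
    polyVal_pow, polyVal_pow, polyVal_X, polyVal_X, iteratedDeriv_one]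
  ring

/-- A common denominator can be used because Δ is itself a polynomial with holomorphic coefficients.
-/
theorem Admissible.add (hφ : DifferentiableOn ℂ φ slitPlane) {F G : Jet → ℂ}
    (hF : Admissible φ F) (hG : Admissible φ G) : Admissible φ fun x => F x + G x := by
  obtain ⟨m, P, hP, hF⟩ := admissible_iff.1 hF
  obtain ⟨n, Q, hQ, hG⟩ := admissible_iff.1 hG
  have hD := holCoeff_DeltaPoly hφ
  refine admissible_iff.2 ⟨m + n, DeltaPoly φ ^ n * P + DeltaPoly φ ^ m * Q, ((hD.pow n).mul hP).add ((hD.pow m).mul hQ),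
    fun x hx => ?_⟩
  simp only [hF x hx, hG x hx]
  have h0 := hx.2
  rw [polyVal_add, polyVal_mul, polyVal_mul, polyVal_pow, polyVal_pow, ← Delta_eq_polyVal hφ hx]
  field_simp
  ring

theorem admissible_pt (hφ : DifferentiableOn ℂ φ slitPlane)
    (hψ : DifferentiableOn ℂ ψ slitPlane) (i : ℕ) : Admissible φ fun x => pt φ ψ x i := by
  have hjet : ∀ n (a : Fin 2), Admissible φ fun x => x (n, a) := by
    intro n a
    cases n with
    | zero =>
      fin_cases a
      · exact admissible_base Prod.fst differentiable_fst.differentiableOn fun _ _ => rfl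
      · exact admissible_base Prod.snd differentiable_snd.differentiableOn fun _ _ => rfl
    | succ n => exact admissible_poly _ (holCoeff_X (n, a)) fun x _ => (polyVal_X x (n, a)).symm
  match i with
  | 0 =>
    refine admissible_iff.2 ⟨1, MvPolynomial.C (fun _ => 1),
      holCoeff_C (differentiableOn_const 1), fun x hx => ?_⟩
    simp only [pt_zero hφ hx, pow_one, polyVal_C, mul_one]
  | 1 => exact admissible_const _
  | i + 2 =>
    have hj : i % 4 = 0 ∨ i % 4 = 1 ∨ i % 4 = 2 ∨ i % 4 = 3 := by omega
    rcases hj with hj | hj | hj | hj <;> simp only [pt, hj]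
    · exact hjet _ _
    · exact hjet _ _
    · exact admissible_base _ (differentiableOn_snd (differentiableOn_iteratedDeriv hφ (i / 4)))
        fun _ _ => rfl
    · exact admissible_base _ (differentiableOn_snd (differentiableOn_iteratedDeriv hψ (i / 4)))
        fun _ _ => rfl

theorem admissible_mono (hφ : DifferentiableOn ℂ φ slitPlane)
    (hψ : DifferentiableOn ℂ ψ slitPlane) (n i m : ℕ) :
    Admissible φ fun x => mono (pt φ ψ x) n i m := by
  have hpow : ∀ i e, Admissible φ fun x => pt φ ψ x i ^ e := fun i e => by
    induction e with
    | zero => simpa using admissible_const (φ := φ) 1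
    | succ e ih => simpa only [pow_succ] using ih.mul (admissible_pt hφ hψ i)
  induction n generalizing i m with
  | zero => exact admissible_const 1
  | succ n ih => exact (hpow _ _).mul (ih _ _)

theorem admissible_ev (hφ : DifferentiableOn ℂ φ slitPlane) (hψ : DifferentiableOn ℂ ψ slitPlane)
    (p : Ex Empty) : Admissible φ fun x => p.ev (pt φ ψ x) fun b => noLeaf b x := by
  induction p with
  | nf l =>
    simp only [Ex.ev]
    induction l with
    | nil => exact admissible_const 0
    | cons m c t ih =>
      exact ((admissible_const (c : ℂ)).mul (admissible_mono hφ hψ _ _ m)).add hφ ih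
  | var i => exact admissible_pt hφ hψ i
  | leaf b => exact b.elim
  | plus p q hp hq => exact hp.add hφ hq
  | times p q hp hq => exact hp.mul hq

theorem admissible_F2 (hφ : DifferentiableOn ℂ φ slitPlane)
    (hψ : DifferentiableOn ℂ ψ slitPlane) : Admissible φ (F20 φ + F21 φ ψ) :=
  (admissible_ev hφ hψ F2P).congr (rep_F2 hφ hψ)

/-- The coefficients become leaves. Their holomorphy is dropped, as they are never differentiated in
v or u. -/
theorem Admissible.exists_rep (hφ : DifferentiableOn ℂ φ slitPlane) {F : Jet → ℂ}
    (hF : Admissible φ F) : ∃ p, Rep φ ψ baseFn F p := by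
  obtain ⟨m, P, -, hF⟩ := admissible_iff.1 hF
  have hP : ∃ q : Ex (ℂ × ℂ → ℂ), ∀ x,
      polyVal x P = q.ev (pt φ ψ x) fun b => baseFn b x := by
    clear hF
    induction P using MvPolynomial.induction_on with
    | C g => exact ⟨leaf g, fun x => polyVal_C x g⟩
    | add P Q hP hQ =>
      obtain ⟨p, hp⟩ := hP
      obtain ⟨q, hq⟩ := hQ
      exact ⟨plus p q, fun x => by rw [polyVal_add, hp, hq]; rfl⟩
    | mul_X P i hP =>
      obtain ⟨p, hp⟩ := hP
      exact ⟨times p (jet (i.1 + 1) i.2), fun x => by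
        rw [polyVal_mul, polyVal_X, hp, Ex.ev, jet, ev_x, pt_jet]⟩
  have hD : ∃ q : Ex (ℂ × ℂ → ℂ), ∀ x ∈ domain φ,
      (Delta φ x ^ m)⁻¹ = q.ev (pt φ ψ x) fun b => baseFn b x := by
    clear hF
    induction m with
    | zero => exact ⟨leaf fun _ => 1, fun x _ => by simp [Ex.ev]⟩
    | succ m ih =>
      obtain ⟨q, hq⟩ := ih
      exact ⟨times q (x 0), fun x hx => by
        rw [pow_succ, mul_inv, hq x hx, Ex.ev, ev_x, pt_zero hφ hx]⟩
  obtain ⟨p, hp⟩ := hP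
  obtain ⟨q, hq⟩ := hD
  exact ⟨times q p, fun x hx => by rw [Ex.ev, ← hp, ← hq x hx]; exact hF x hx⟩

end TwoPrimary

namespace TwoPrimary

open Ex

variable {φ ψ : ℂ → ℂ}

/-! ### Differences of functions, and independence of higher jets -/

theorem dev_lift {β : Type} (val : ℕ → ℂ) (lv : β → ℂ) (e : Empty → ℂ) (w : ℕ → ℂ)
    (t : Ex Empty) : (lift t : Ex β).dev val lv w = t.dev val e w := by
  induction t with
  | nf l => rfl
  | var i => rfl
  | leaf b => exact b.elim
  | plus p q hp hq => simp [Ex.lift, dev, hp, hq]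
  | times p q hp hq => simp [Ex.lift, dev, hp, hq, ev_lift _ e]

/-- The difference of two expressions. -/
def diffEx (p : Ex (ℂ × ℂ → ℂ)) (t : Ex Empty) : Ex (ℂ × ℂ → ℂ) :=
  plus p (times (leaf fun _ => -1) (lift t))

theorem Rep.diff {F T : Jet → ℂ} {p : Ex (ℂ × ℂ → ℂ)} {t : Ex Empty} (hF : Rep φ ψ baseFn F p)
    (hT : Rep0 φ ψ T t) : Rep φ ψ baseFn (fun x => F x - T x) (diffEx p t) := fun x hx => by
  simp only [diffEx, ev, ev_lift _ fun b => noLeaf b x, hF x hx, hT x hx]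
  ring

theorem Rep.eth_eq_dev (hφ : DifferentiableOn ℂ φ slitPlane) (hψ : DifferentiableOn ℂ ψ slitPlane)
    {F : Jet → ℂ} {p : Ex (ℂ × ℂ → ℂ)} (hF : Rep φ ψ baseFn F p) {k : ℕ} (hk : k ≠ 0)
    (a : Fin 2) {x : Jet} (hx : x ∈ domain φ) :
    TwoPrimary.eth φ k a F x = p.dev (pt φ ψ x) (fun l => baseFn l x)
      (extv (pt φ ψ x) fun n b => faa φ n k x a b) :=
  hF.field hφ hψ hx fun n b h l s => baseFn_update l x (by
    rintro rfl
    exact h (by simp [faa_of_lt φ (Nat.pos_of_ne_zero hk)])) b s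

theorem eth_sub (hφ : DifferentiableOn ℂ φ slitPlane) (hψ : DifferentiableOn ℂ ψ slitPlane)
    {F T : Jet → ℂ} {p : Ex (ℂ × ℂ → ℂ)} {t : Ex Empty} (hF : Rep φ ψ baseFn F p)
    (hT : Rep0 φ ψ T t) {k : ℕ} (hk : k ≠ 0) (a : Fin 2) {x : Jet} (hx : x ∈ domain φ) :
    eth φ k a (fun y => F y - T y) x = eth φ k a F x - eth φ k a T x := by
  have h : eth φ k a T x = t.dev (pt φ ψ x) (fun l => noLeaf l x)
      (extv (pt φ ψ x) fun n b => faa φ n k x a b) :=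
    hT.field hφ hψ hx fun n b _ l => l.elim
  rw [(hF.diff hT).eth_eq_dev hφ hψ hk a hx, hF.eth_eq_dev hφ hψ hk a hx, h, diffEx, dev, dev,
    dev, ev, dev_lift _ _ fun l => noLeaf l x]
  ring

theorem eth11_sub (hφ : DifferentiableOn ℂ φ slitPlane) (hψ : DifferentiableOn ℂ ψ slitPlane)
    {F T : Jet → ℂ} {p : Ex (ℂ × ℂ → ℂ)} {t : Ex Empty} (hF : Rep φ ψ baseFn F p)
    (hT : Rep0 φ ψ T t) (a b : Fin 2) {x : Jet} (hx : x ∈ domain φ) :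
    eth11 φ a b (fun y => F y - T y) x = eth11 φ a b F x - eth11 φ a b T x := by
  have h : eth φ 1 a (eth φ 1 b fun y => F y - T y) x
      = eth φ 1 a (eth φ 1 b F) x - eth φ 1 a (eth φ 1 b T) x := by
    rw [eth_congr hφ (fun y hy => eth_sub hφ hψ hF hT one_ne_zero b hy) hx]
    exact eth_sub hφ hψ (hF.eth_base hφ hψ one_ne_zero b) (hT.eth hφ hψ 1 b) one_ne_zero a hx
  simp only [eth11, h, eth_sub hφ hψ hF hT one_ne_zero _ hx, mul_sub, Finset.sum_sub_distrib]
  ring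

/-- Components of order below n vanish by `faa_of_lt`, those above n by hypothesis; the one of order
n is `faa_self`. -/
theorem eth_eq_of_pd {F : Jet → ℂ} {x : Jet} {n : ℕ}
    (h : ∀ m, n < m → ∀ b, pd (m, b) F x = 0) (a : Fin 2) :
    eth φ n a F x = ∑ b, (dU φ x ^ (n + 1)) a b * pd (n, b) F x := by
  rw [eth, finsum_eq_single _ n, faa_self]
  intro m hm
  refine Finset.sum_eq_zero fun b _ => ?_
  rcases lt_or_gt_of_ne hm with hm | hm
  · simp [faa_of_lt φ hm]
  · rw [h m hm, mul_zero]

theorem eq_zero_of_dU_pow {x : Jet} (hx : x ∈ domain φ) (n : ℕ) {g : Fin 2 → ℂ}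
    (h : ∀ a, ∑ b, (dU φ x ^ n) a b * g b = 0) : g = 0 := by
  refine Matrix.eq_zero_of_mulVec_eq_zero (M := dU φ x ^ n) ?_ (funext h)
  rw [Matrix.det_pow]
  exact pow_ne_zero _ hx.2

theorem Rep.exists_pd_eq_zero (hφ : DifferentiableOn ℂ φ slitPlane)
    (hψ : DifferentiableOn ℂ ψ slitPlane) {F : Jet → ℂ} {p : Ex (ℂ × ℂ → ℂ)}
    (hF : Rep φ ψ baseFn F p) : ∃ N, ∀ n, N ≤ n → ∀ b, ∀ x ∈ domain φ,
      TwoPrimary.pd (n, b) F x = 0 := by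
  obtain ⟨N, hN⟩ := exists_dev_congr p
  refine ⟨max N 2, fun n hn b x hx => ?_⟩
  have h2 : n ≠ 0 := by
    have := (le_max_right N 2).trans hn
    omega
  rw [hF.pd hφ hψ hx fun l s => baseFn_update l x h2 b s,
    hN _ _ _ (extv (pt φ ψ x) 0) (extv_congr fun m hm c => by
      rw [unitVec, Pi.single_eq_of_ne (by omega)]; rfl)]
  change devL _ _ p (extvL _ 0) = 0
  rw [map_zero, map_zero]

theorem pd_eq_zero_of_eth (hφ : DifferentiableOn ℂ φ slitPlane)
    (hψ : DifferentiableOn ℂ ψ slitPlane) {F : Jet → ℂ} {p : Ex (ℂ × ℂ → ℂ)}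
    (hF : Rep φ ψ baseFn F p) {k : ℕ}
    (h : ∀ n, k ≤ n → ∀ a, ∀ x ∈ domain φ, eth φ n a F x = 0) {n : ℕ} (hn : k ≤ n) (b : Fin 2)
    {x : Jet} (hx : x ∈ domain φ) : pd (n, b) F x = 0 := by
  obtain ⟨N, hN⟩ := hF.exists_pd_eq_zero hφ hψ
  -- Descending induction on n from the highest jet that can occur: once all higher derivatives
  -- vanish, ð_{n,a}F = 0 is a linear system with the invertible matrix ∂U^{n+1}.
  have key : ∀ d n, k ≤ n → N ≤ n + d → ∀ b, ∀ x ∈ domain φ, pd (n, b) F x = 0 := by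
    intro d
    induction d with
    | zero => exact fun n _ hn => hN n hn
    | succ d ih =>
      intro n hk hn b x hx
      have h1 := fun a => (eth_eq_of_pd (φ := φ) (F := F) (x := x)
        (fun m hm b => ih m (by omega) (by omega) b x hx) a).symm.trans (h n hk a x hx)
      exact congrFun (eq_zero_of_dU_pow hx _ (g := fun b => pd (n, b) F x) h1) b
  exact key N n hn (by omega) b x hx

theorem update_mem_domain (hφ : DifferentiableOn ℂ φ slitPlane) {x : Jet} (hx : x ∈ domain φ)
    {n : ℕ} (hn : 2 ≤ n) (b : Fin 2) (s : ℂ) : Function.update x (n, b) s ∈ domain φ := by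
  have h : ∀ m < 2, ∀ c, Function.update x (n, b) s (m, c) = x (m, c) := fun m hm c =>
    update_ne x (fun h => by have := congrArg Prod.fst h; simp at this; omega) s
  have h01 : Function.update x (n, b) s (0, 1) ∈ slitPlane := by
    rw [h 0 (by norm_num)]
    exact hx.1
  refine ⟨h01, ?_⟩
  rw [Delta_eq hφ h01, h 0 (by norm_num), h 1 (by norm_num), h 1 (by norm_num),
    ← Delta_eq hφ hx.1]
  exact hx.2

/-- On the domain, `F` does not depend on the coordinates `u^b_n` with `n ≥ 2`. -/
def Indep (φ : ℂ → ℂ) (F : Jet → ℂ) : Prop :=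
  ∀ n, 2 ≤ n → ∀ b, ∀ x ∈ domain φ, ∀ s, F (Function.update x (n, b) s) = F x

theorem Indep.pd_eq_zero {F : Jet → ℂ} (hF : Indep φ F) {n : ℕ} (hn : 2 ≤ n) (b : Fin 2)
    {x : Jet} (hx : x ∈ domain φ) : TwoPrimary.pd (n, b) F x = 0 := by
  simp [TwoPrimary.pd, hF n hn b x hx]

/-- As Δ does not involve u^b_n for n ≥ 2, the whole complex line in such a direction lies in the
domain, so a vanishing derivative gives a constant. -/
theorem Rep.indep (hφ : DifferentiableOn ℂ φ slitPlane) (hψ : DifferentiableOn ℂ ψ slitPlane)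
    {F : Jet → ℂ} {p : Ex (ℂ × ℂ → ℂ)} (hF : Rep φ ψ baseFn F p)
    (h : ∀ n, 2 ≤ n → ∀ b, ∀ x ∈ domain φ, TwoPrimary.pd (n, b) F x = 0) : Indep φ F := by
  intro n hn b x hx s
  have hL : ∀ (l : ℂ × ℂ → ℂ) (y : Jet) s, baseFn l (Function.update y (n, b) s) = baseFn l y :=
    fun l y s => baseFn_update l y (by omega) b s
  have hd : ∀ t, HasDerivAt (fun s => F (Function.update x (n, b) s)) 0 t := fun t => by
    have ht := update_mem_domain hφ hx hn b t
    have h1 := hF.hasDerivAt hφ hψ (γ := fun s => Function.update x (n, b) s) (t := t) ht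
      (hasDerivAt_update x n b t) (fun l s => by rw [hL, hL])
    have h2 := hF.pd hφ hψ ht fun l s => hL l _ s
    rw [h n hn b _ ht] at h2
    rwa [← h2] at h1
  have := is_const_of_deriv_eq_zero (fun t => (hd t).differentiableAt) (fun t => (hd t).deriv) s
    (x (n, b))
  rwa [Function.update_eq_self] at this

theorem Indep.pd (hφ : DifferentiableOn ℂ φ slitPlane) {F : Jet → ℂ} (hF : Indep φ F) {m : ℕ}
    (hm : m < 2) (c : Fin 2) : Indep φ (TwoPrimary.pd (m, c) F) := by
  intro n hn b x hx s
  have hne : (m, c) ≠ (n, b) := fun h => by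
    have := congrArg Prod.fst h
    simp at this
    omega
  rw [TwoPrimary.pd, TwoPrimary.pd, update_ne x hne]
  refine Filter.EventuallyEq.deriv_eq ?_
  filter_upwards [eventually_update_mem_domain hφ hx m c] with t ht
  rw [← Function.update_comm hne, hF n hn b _ ht]

theorem dU_update (hφ : DifferentiableOn ℂ φ slitPlane) {n : ℕ} (hn : 2 ≤ n) (b : Fin 2) {x : Jet}
    (hx : x ∈ domain φ) (s : ℂ) : dU φ (Function.update x (n, b) s) = dU φ x := by
  have h : ∀ m < 2, ∀ c, Function.update x (n, b) s (m, c) = x (m, c) := fun m hm c =>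
    update_ne x (fun h => by have := congrArg Prod.fst h; simp at this; omega) s
  rw [dU_eq hφ (update_mem_domain hφ hx hn b s).1, dU_eq hφ hx.1, h 0 (by norm_num),
    h 1 (by norm_num), h 1 (by norm_num)]

theorem Indep.eth_one_eq {F : Jet → ℂ} (hF : Indep φ F) (a : Fin 2) {x : Jet}
    (hx : x ∈ domain φ) :
    eth φ 1 a F x = ∑ b, (dU φ x ^ 2) a b * TwoPrimary.pd (1, b) F x :=
  eth_eq_of_pd (fun _ hm b => hF.pd_eq_zero hm b hx) a

/-- On such functions ð_{1,a} reduces to (∂U²)_a^b ∂/∂u^b_1, and ∂U involves only jets of order 0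
and 1. -/
theorem Indep.eth_one (hφ : DifferentiableOn ℂ φ slitPlane) {F : Jet → ℂ} (hF : Indep φ F)
    (a : Fin 2) : Indep φ (eth φ 1 a F) := by
  intro n hn b x hx s
  rw [hF.eth_one_eq a hx, hF.eth_one_eq a (update_mem_domain hφ hx hn b s),
    dU_update hφ hn b hx]
  simp only [hF.pd hφ one_lt_two _ n hn b x hx s]

theorem indep_corr0 (hφ : DifferentiableOn ℂ φ slitPlane) (a b c : Fin 2) :
    Indep φ (corr0 φ a b [c]) := by
  have h0 : Indep φ (twoPt φ a b) := fun n hn d x _ s => twoPt_update φ a b x (by omega) d s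
  have h1 : ∀ x, corr0 φ a b [c] x
      = ∑ d, (dU φ x ^ 1) c d * pd (0, d) (twoPt φ a b) x := fun x =>
    eth_eq_of_pd (fun m hm d => by
      have hm : m ≠ 0 := by omega
      simp [pd, twoPt_update φ a b x hm]) c
  intro n hn d x hx s
  rw [h1, h1, dU_update hφ hn d hx]
  simp only [h0.pd hφ two_pos _ n hn d x hx s]

theorem Indep.eth11 (hφ : DifferentiableOn ℂ φ slitPlane) {F : Jet → ℂ} (hF : Indep φ F)
    (a b : Fin 2) : Indep φ (TwoPrimary.eth11 φ a b F) := by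
  intro n hn d x hx s
  simp only [TwoPrimary.eth11, (hF.eth_one hφ b).eth_one hφ a n hn d x hx s,
    hF.eth_one hφ _ n hn d x hx s, indep_corr0 hφ _ _ _ n hn d x hx s]

/-! ### The two recursions -/

theorem ev_eq_of_isZero_sub {val : ℕ → ℂ} (hv : IsPoint val) {β : Type} {lv : β → ℂ}
    {p q : Ex β} (h : isZero (p - q) = true) : p.ev val lv = q.ev val lv := by
  have := ev_eq_zero (val := val) (lv := lv) h
  rw [ev_sub hv] at this
  exact sub_eq_zero.1 this

/-- The variables of a normal form have index below 22, which leaves only jets of order at most 4.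
This settles (TRR21) for all k ≥ 5 at once. -/
theorem Rep.pd_of_isNF (hφ : DifferentiableOn ℂ φ slitPlane) (hψ : DifferentiableOn ℂ ψ slitPlane)
    {T : Jet → ℂ} {t : Ex Empty} (hT : Rep0 φ ψ T t) (ht : t.isNF = true) {n : ℕ} (hn : 5 ≤ n)
    (b : Fin 2) {x : Jet} (hx : x ∈ domain φ) : TwoPrimary.pd (n, b) T x = 0 := by
  rw [hT.pd hφ hψ hx fun l => l.elim]
  unfold Ex.isNF at ht
  split at ht
  · rw [dev, Terms.dev_eq_sum]
    refine Finset.sum_eq_zero fun i hi => ?_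
    have h0 : ∀ m, m < 5 → ∀ c, unitVec n b m c = 0 := fun m hm c => by
      rw [unitVec, Pi.single_eq_of_ne (by omega)]
      rfl
    have hi : i < 22 := Finset.mem_range.1 hi
    have : extv (pt φ ψ x) (unitVec n b) i = 0 := by
      match i with
      | 0 => simp [extv, h0]
      | 1 => rfl
      | i + 2 =>
        have h4 := h0 (i / 4) (by omega)
        simp only [extv, h4, h0 0 (by norm_num), zero_mul]
        split <;> rfl
    rw [this, mul_zero]
  · simp at ht

/-- The case k = 2 is assumed as an equality of values rather than of normal forms, because for
F_{2,0} + F_{2,1} it holds only modulo genusOne = 0. -/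
theorem eth_eq_R (hφ : DifferentiableOn ℂ φ slitPlane) (hψ : DifferentiableOn ℂ ψ slitPlane)
    {T : Jet → ℂ} {t : Ex Empty} (hT : Rep0 φ ψ T t) (ht : t.isNF = true)
    (h2 : ∀ a, ∀ x ∈ domain φ, (ethP 2 a t).ev (pt φ ψ x) (fun l => noLeaf l x)
      = (RP 2 a).ev (pt φ ψ x) fun l => noLeaf l x)
    (h3 : ∀ a, isZero (ethP 3 a t - RP 3 a) = true)
    (h4 : ∀ a, isZero (ethP 4 a t - RP 4 a) = true) (k : ℕ) (hk : 2 ≤ k) (a : Fin 2) (x : Jet)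
    (hx : x ∈ domain φ) : eth φ k a T x = R φ ψ k a x := by
  have hv := isPoint_pt (ψ := ψ) hφ hx
  by_cases h5 : 5 ≤ k
  · have hR : R φ ψ k a x = 0 := by
      obtain ⟨j, rfl⟩ : ∃ j, k = j + 5 := ⟨k - 5, by omega⟩
      rfl
    rw [hR, eth_eq_of_pd fun m hm b => hT.pd_of_isNF hφ hψ ht (by omega) b hx]
    exact Finset.sum_eq_zero fun b _ => by rw [hT.pd_of_isNF hφ hψ ht h5 b hx, mul_zero]
  · rw [hT.eth hφ hψ k a x hx, rep_R hφ hψ k a x hx]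
    have : k = 2 ∨ k = 3 ∨ k = 4 := by omega
    rcases this with rfl | rfl | rfl
    · exact h2 a x hx
    · exact ev_eq_of_isZero_sub hv (h3 a)
    · exact ev_eq_of_isZero_sub hv (h4 a)

theorem ev_genusOne_factor (hφ : DifferentiableOn ℂ φ slitPlane) {x : Jet} (hx : x ∈ domain φ) :
    ((32 : ℤ) • (Ex.x 1 * jet 1 1 * jet 1 1 * jet 1 1
      * ((4 : ℤ) • (jet 1 0 * jet 1 0) + jet 1 1 * jet 1 1 * phi 1) * genusOneP)).ev (pt φ ψ x)
        (fun l => noLeaf l x)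
      = 2 / 15 * x (1, 1) ^ 3 * (4 * x (1, 0) ^ 2 + x (1, 1) ^ 2 * deriv φ (x (0, 1)))
          * genusOne φ ψ (x (0, 1)) := by
  have hv := isPoint_pt (ψ := ψ) hφ hx
  have h1 : pt φ ψ x 1 = 1 / 5760 := rfl
  simp only [ev_smul hv, ev_mul hv, ev_add, ev_x, jet, phi, pt_jet, pt_phi, h1,
    ← rep_genusOne hφ x hx, iteratedDeriv_one]
  push_cast
  ring

theorem commutator_eq (hφ : DifferentiableOn ℂ φ slitPlane) (hψ : DifferentiableOn ℂ ψ slitPlane)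
    {x : Jet} (hx : x ∈ domain φ) :
    eth11 φ 0 0 (R φ ψ 2 0) x - eth φ 2 0 (R11 φ ψ 0 0) x =
        2 / 15 * x (1, 1) ^ 3 * (4 * x (1, 0) ^ 2 + x (1, 1) ^ 2 * deriv φ (x (0, 1)))
          * genusOne φ ψ (x (0, 1)) := by
  have hv := isPoint_pt (ψ := ψ) hφ hx
  rw [(rep_R hφ hψ 2 0).eth11 hφ hψ 0 0 x hx, (rep_R11 hφ hψ 0 0).eth hφ hψ 2 0 x hx,
    ← ev_sub hv, ev_eq_of_isZero_sub hv isZero_commutator, ev_genusOne_factor hφ hx]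

theorem solves_F2 (hφ : DifferentiableOn ℂ φ slitPlane) (hψ : DifferentiableOn ℂ ψ slitPlane)
    (h : ∀ u ∈ slitPlane, genusOne φ ψ u = 0) : Solves φ ψ (F20 φ + F21 φ ψ) := by
  obtain ⟨hnf, -, h2, h3, h4, h11⟩ := isZero_F2P
  have hF := rep_F2 hφ hψ
  have key : ∀ {p q : Ex Empty}, isZero (elim (p - q)) = true → ∀ x ∈ domain φ,
      p.ev (pt φ ψ x) (fun l => noLeaf l x) = q.ev (pt φ ψ x) fun l => noLeaf l x := by
    intro p q hpq x hx
    have h0 := ev_eq_zero (val := pt φ ψ x) (lv := fun l => noLeaf l x) hpq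
    rw [ev_elim hφ hψ h hx, ev_sub (isPoint_pt hφ hx)] at h0
    exact sub_eq_zero.1 h0
  refine ⟨eth_eq_R hφ hψ hF ?_ (fun a => key (h2 a)) h3 h4, fun a b x hx => ?_⟩
  · rw [Bool.and_eq_true] at hnf
    exact hnf.1
  · rw [hF.eth11 hφ hψ a b x hx, rep_R11 hφ hψ a b x hx]
    exact key (h11 a b) x hx

theorem eth_sub_eq_zero (hφ : DifferentiableOn ℂ φ slitPlane)
    (hψ : DifferentiableOn ℂ ψ slitPlane) {F T : Jet → ℂ} {p : Ex (ℂ × ℂ → ℂ)} {t : Ex Empty}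
    (hF : Rep φ ψ baseFn F p) (hT : Rep0 φ ψ T t)
    (hF2 : ∀ k, 2 ≤ k → ∀ a, ∀ x ∈ domain φ, eth φ k a F x = R φ ψ k a x)
    (hT2 : ∀ k, 2 ≤ k → ∀ a, ∀ x ∈ domain φ, eth φ k a T x = R φ ψ k a x) :
    Indep φ fun x => F x - T x := by
  refine (hF.diff hT).indep hφ hψ fun n hn b x hx => ?_
  refine pd_eq_zero_of_eth hφ hψ (hF.diff hT) (k := 2) (fun k hk a y hy => ?_) hn b hx
  rw [eth_sub hφ hψ hF hT (by omega) a hy, hF2 k hk a y hy, hT2 k hk a y hy, sub_self]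

/-- With ∂u = 1 and |∂v| = |φ'(u)| + 1, the number (∂v)² exceeds φ'(u) in absolute value, so neither
Δ nor the cofactor of genusOne can vanish. -/
theorem exists_mem_domain (hφ : DifferentiableOn ℂ φ slitPlane) {u : ℂ} (hu : u ∈ slitPlane) :
    ∃ x ∈ domain φ, x (0, 1) = u ∧ x (1, 1) = 1 ∧ 4 * x (1, 0) ^ 2 + deriv φ u ≠ 0 := by
  obtain ⟨c, hc⟩ : ∃ c : ℂ, ‖c‖ = ‖deriv φ u‖ + 1 :=
    ⟨((‖deriv φ u‖ + 1 : ℝ) : ℂ), by rw [Complex.norm_real, Real.norm_of_nonneg (by positivity)]⟩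
  have hn0 := norm_nonneg (deriv φ u)
  obtain ⟨x, h01, h10, h11⟩ : ∃ x : Jet, x (0, 1) = u ∧ x (1, 0) = c ∧ x (1, 1) = 1 :=
    ⟨fun i => if i = (0, 1) then u else if i = (1, 0) then c else 1, by simp⟩
  have h01' : x (0, 1) ∈ slitPlane := by rwa [h01]
  refine ⟨x, ⟨h01', ?_⟩, h01, h11, ?_⟩
  · rw [Delta_eq hφ h01', h01, h10, h11]
    intro h0
    have : ‖c‖ ^ 2 = ‖deriv φ u‖ := by
      rw [← norm_pow]
      congr 1
      linear_combination h0
    nlinarith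
  · rw [h10]
    intro h0
    have : 4 * ‖c‖ ^ 2 = ‖deriv φ u‖ := by
      rw [← norm_neg (deriv φ u), ← eq_neg_of_add_eq_zero_left h0, norm_mul, norm_pow]
      norm_num
    nlinarith

theorem genusOne_eq_zero (hφ : DifferentiableOn ℂ φ slitPlane)
    (hψ : DifferentiableOn ℂ ψ slitPlane) {F : Jet → ℂ} (hF : Admissible φ F)
    (hs : Solves φ ψ F) : ∀ u ∈ slitPlane, genusOne φ ψ u = 0 := by
  obtain ⟨p, hp⟩ := hF.exists_rep (ψ := ψ) hφ
  obtain ⟨hnf, h2, h3, h4, h5⟩ := isZero_T2P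
  set T : Jet → ℂ := fun x => T2P.ev (pt φ ψ x) fun l => noLeaf l x with hTdef
  have hT : Rep0 φ ψ T T2P := fun x _ => rfl
  have hK := eth_sub_eq_zero hφ hψ hp hT hs.1 (eth_eq_R hφ hψ hT hnf
    (fun a x hx => ev_eq_of_isZero_sub (isPoint_pt hφ hx) (h2 a)) h3 h4)
  set E : Jet → ℂ := fun x => R11 φ ψ 0 0 x - eth11 φ 0 0 T x with hEdef
  have hE : Rep0 φ ψ E (R11P 0 0 - eth11P 0 0 T2P) := fun x hx => by
    rw [ev_sub (isPoint_pt hφ hx), ← rep_R11 hφ hψ 0 0 x hx, ← hT.eth11 hφ hψ 0 0 x hx]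
  have hE2 : ∀ x ∈ domain φ, E x = eth11 φ 0 0 (fun x => F x - T x) x := fun x hx => by
    rw [eth11_sub hφ hψ hp hT 0 0 hx, hs.2 0 0 x hx]
  -- E itself is an explicit expression that may contain higher jets; only the existence of a
  -- solution F forces it to be independent of them.
  have hE3 : Indep φ E := fun n hn b x hx s => by
    rw [hE2 _ (update_mem_domain hφ hx hn b s), hE2 x hx]
    exact hK.eth11 hφ 0 0 n hn b x hx s
  intro u hu
  obtain ⟨x, hx, h01, h11, hne⟩ := exists_mem_domain hφ hu
  have h6 := ev_eq_zero (val := pt φ ψ x) (lv := fun l => noLeaf l x) h5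
  -- The term ð_{2,0}E vanishes by independence, which leaves the cofactor times genusOne.
  rw [ev_add, ev_genusOne_factor hφ hx, ← hE.eth hφ hψ 2 0 x hx,
    eth_eq_of_pd fun m hm b => hE3.pd_eq_zero (by omega) b hx] at h6
  simp only [hE3.pd_eq_zero le_rfl _ hx, mul_zero, Finset.sum_const_zero, zero_add, h01, h11,
    one_pow, mul_one, one_mul] at h6
  exact (mul_eq_zero.1 h6).resolve_left (mul_ne_zero (by norm_num) hne)

end TwoPrimary

namespace TwoPrimary

open Ex

variable {φ ψ : ℂ → ℂ}

/-! ### The small phase space -/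

theorem smallPhase_subset_domain (hφ : DifferentiableOn ℂ φ slitPlane) {x : Jet}
    (hx : x ∈ smallPhase) : x ∈ domain φ := by
  obtain ⟨h01, h10, h11, -⟩ := hx
  refine ⟨h01, ?_⟩
  rw [Delta_eq hφ h01, h10, h11]
  norm_num

theorem dU_smallPhase (hφ : DifferentiableOn ℂ φ slitPlane) {x : Jet} (hx : x ∈ smallPhase) :
    dU φ x = 1 := by
  obtain ⟨h01, h10, h11, -⟩ := hx
  rw [dU_eq hφ h01, h10, h11, mul_zero, Matrix.one_fin_two]

theorem update_mem_smallPhase {x : Jet} (hx : x ∈ smallPhase) (b : Fin 2) {s : ℂ}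
    (hs : b = 1 → s ∈ slitPlane) : Function.update x (0, b) s ∈ smallPhase := by
  obtain ⟨h01, h10, h11, h⟩ := hx
  refine ⟨?_, by rwa [update_ne x (by simp)], by rwa [update_ne x (by simp)], fun n hn a => ?_⟩
  · by_cases hb : b = 1
    · subst hb
      rw [Function.update_self]
      exact hs rfl
    · rwa [update_ne x fun h' => hb (congrArg Prod.snd h').symm]
  · rw [update_ne x fun h' => by have := congrArg Prod.fst h'; simp at this; omega]
    exact h n hn a

/-- On the small phase space ∂ reduces to ∂/∂v, which is tangent to it. -/
theorem dtot_smallPhase {F : Jet → ℂ} {c : ℂ} (hF : ∀ x ∈ smallPhase, F x = c) {x : Jet}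
    (hx : x ∈ smallPhase) : dtot F x = 0 := by
  have h0 : pd (0, 0) F x = 0 := by
    have : ∀ s, F (Function.update x (0, 0) s) = c := fun s =>
      hF _ (update_mem_smallPhase hx 0 (by simp))
    simp [pd, this]
  refine finsum_eq_zero_of_forall_eq_zero fun n => Finset.sum_eq_zero fun b _ => ?_
  obtain ⟨-, -, h11, h⟩ := hx
  cases n with
  | zero =>
    fin_cases b
    · simp [h0]
    · simp [h11]
  | succ n => rw [h _ (by omega), zero_mul]

theorem faa_smallPhase (hφ : DifferentiableOn ℂ φ slitPlane) (n : ℕ) (a b : Fin 2) {x : Jet}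
    (hx : x ∈ smallPhase) : faa φ (n + 1) 0 x a b = 0 := by
  induction n generalizing a b x with
  | zero =>
    refine dtot_smallPhase (c := (1 : Matrix (Fin 2) (Fin 2) ℂ) a b) (fun y hy => ?_) hx
    rw [faa, dU_smallPhase hφ hy]
  | succ n ih => exact dtot_smallPhase (c := 0) (fun y hy => ih a b hy) hx

/-- There ∂U = 1 is constant, so ∂_{0,a} only has components along v and u and is tangent to the
small phase space. This lets ∂_{1,a} be replaced by ð_{1,a}. -/
theorem d0_smallPhase (hφ : DifferentiableOn ℂ φ slitPlane) {F : Jet → ℂ}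
    (hF : ∀ x ∈ smallPhase, F x = 0) (a : Fin 2) {x : Jet} (hx : x ∈ smallPhase) :
    d0 φ a F x = 0 := by
  refine finsum_eq_zero_of_forall_eq_zero fun n => Finset.sum_eq_zero fun b _ => ?_
  cases n with
  | zero =>
    have h : pd (0, b) F x = 0 := by
      have h1 : (fun s => F (Function.update x (0, b) s)) =ᶠ[nhds (x (0, b))] fun _ => 0 := by
        have h2 : ∀ᶠ s in nhds (x (0, b)), b = 1 → s ∈ slitPlane := by
          by_cases hb : b = 1
          · subst hb
            filter_upwards [isOpen_slitPlane.mem_nhds hx.1] with s hs _ using hs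
          · exact Filter.Eventually.of_forall fun s h => absurd h hb
        filter_upwards [h2] with s hs
        exact hF _ (update_mem_smallPhase hx b hs)
      rw [pd, h1.deriv_eq, deriv_const]
    rw [h, mul_zero]
  | succ n => rw [faa_smallPhase hφ n a b hx, zero_mul]

theorem d1_smallPhase (hφ : DifferentiableOn ℂ φ slitPlane) {F : Jet → ℂ}
    (hF : ∀ x ∈ smallPhase, F x = 0) (a : Fin 2) {x : Jet} (hx : x ∈ smallPhase) :
    d1 φ a F x = eth φ 1 a F x := by
  simp [d1, d0_smallPhase hφ hF _ hx]

theorem ev_of_isSmall {x : Jet} (hx : x ∈ smallPhase) {t : Ex Empty} (ht : t.isSmall = true) :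
    t.ev (pt φ ψ x) (fun l => noLeaf l x) = 0 := by
  have hz : ∀ i ∈ [7, 10, 11, 14, 15, 18, 19], i < numVars ∧ pt φ ψ x i = 0 := by
    obtain ⟨-, -, h11, h⟩ := hx
    have e := pt_jet φ ψ x
    simp only [List.mem_cons, List.not_mem_nil, or_false]
    rintro i (rfl | rfl | rfl | rfl | rfl | rfl | rfl) <;> refine ⟨by norm_num, ?_⟩
    · exact (e 1 1).trans h11
    · exact (e 2 0).trans (h 2 (by norm_num) 0)
    · exact (e 2 1).trans (h 2 (by norm_num) 1)
    · exact (e 3 0).trans (h 3 (by norm_num) 0)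
    · exact (e 3 1).trans (h 3 (by norm_num) 1)
    · exact (e 4 0).trans (h 4 (by norm_num) 0)
    · exact (e 4 1).trans (h 4 (by norm_num) 1)
  cases t with
  | nf l =>
    rw [Ex.ev]
    rw [Ex.isSmall] at ht
    induction l with
    | nil => rfl
    | cons m c p ih =>
      rw [Terms.small] at ht
      cases hm : [7, 10, 11, 14, 15, 18, 19].all fun i => Nat.beq (m / 256 ^ i % 256) 0 <;>
        rw [hm] at ht
      · obtain ⟨i, hi, hd⟩ := List.all_eq_false.1 hm
        obtain ⟨hi1, hi2⟩ := hz i hi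
        have hd : 1 ≤ m / 256 ^ i % 256 := by
          by_contra h'
          exact hd (by rw [show m / 256 ^ i % 256 = 0 by omega]; rfl)
        rw [Terms.ev, ih ht, mono_eq_mul _ _ 0 i m hi1 hd, zero_add, hi2]
        ring
      · simp at ht
  | _ => simp [Ex.isSmall] at ht

theorem vanishesOnSmall_F2 (hφ : DifferentiableOn ℂ φ slitPlane)
    (hψ : DifferentiableOn ℂ ψ slitPlane) : VanishesOnSmall φ (F20 φ + F21 φ ψ) := by
  obtain ⟨h0, h1, -⟩ := isZero_F2P
  rw [Bool.and_eq_true] at h0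
  have hF := rep_F2 hφ hψ
  have hz : ∀ x ∈ smallPhase, (F20 φ + F21 φ ψ) x = 0 := fun x hx => by
    rw [hF x (smallPhase_subset_domain hφ hx)]
    exact ev_of_isSmall hx h0.2
  refine ⟨hz, fun a x hx => ?_⟩
  rw [d1_smallPhase hφ hz a hx, hF.eth hφ hψ 1 a x (smallPhase_subset_domain hφ hx)]
  exact ev_of_isSmall hx (h1 a)

/-! ### Uniqueness -/

/-- A function whose derivatives in all directions `u^b_n`, `n > 0`, vanish only depends on
`(v, u)`. -/
theorem Rep.eq_of_pd_eq_zero (hφ : DifferentiableOn ℂ φ slitPlane)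
    (hψ : DifferentiableOn ℂ ψ slitPlane) {F : Jet → ℂ} {p : Ex (ℂ × ℂ → ℂ)}
    (hF : Rep φ ψ baseFn F p)
    (h : ∀ n, n ≠ 0 → ∀ b, ∀ x ∈ domain φ, TwoPrimary.pd (n, b) F x = 0) {x y : Jet}
    (hx : x ∈ domain φ) (hy : y ∈ domain φ) (hxy : ∀ b, x (0, b) = y (0, b)) : F x = F y := by
  -- The complex line through x and y keeps (v, u) fixed, so Δ restricted to it is a polynomial in
  -- t, not identically zero.
  set γ : ℂ → Jet := fun t i => x i + t * (y i - x i) with hγ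
  have hb : ∀ t b, γ t (0, b) = x (0, b) := fun t b => by simp [hγ, hxy b]
  set P : Polynomial ℂ := (.C (x (1, 0)) + .X * .C (y (1, 0) - x (1, 0))) ^ 2
    - .C (deriv φ (x (0, 1))) * (.C (x (1, 1)) + .X * .C (y (1, 1) - x (1, 1))) ^ 2 with hP
  have hΔ : ∀ t, Delta φ (γ t) = P.eval t := fun t => by
    rw [Delta_eq hφ (by rw [hb]; exact hx.1), hb]
    simp [hγ, hP]
  have hP0 : P ≠ 0 := by
    intro h0
    have h1 := hΔ 0
    rw [h0, Polynomial.eval_zero] at h1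
    refine hx.2 ?_
    rw [← h1]
    congr 1
    funext i
    simp [hγ]
  set S : Set ℂ := (P.rootSet ℂ)ᶜ with hS
  have hSd : ∀ t, t ∈ S ↔ γ t ∈ domain φ := fun t => by
    rw [hS, Set.mem_compl_iff, Polynomial.mem_rootSet_of_ne hP0, domain, Set.mem_ofPred_eq, hb, hΔ]
    simp [hx.1]
  have hfin : (P.rootSet ℂ).Finite := P.rootSet_finite ℂ
  -- The line meets the domain in the complement of finitely many points, which is connected because
  -- ℂ has real dimension 2.
  have hconn : IsPreconnected S :=
    (hfin.countable.isConnected_compl_of_one_lt_rank (by simp)).isPreconnected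
  have hd : ∀ t ∈ S, HasDerivAt (fun s => F (γ s)) 0 t := fun t ht => by
    have ht := (hSd t).1 ht
    have h1 := hF.hasDerivAt hφ hψ (γ := γ) (t := t) (ξ := fun n b => y (n, b) - x (n, b)) ht
      (fun n b => by
        simpa [hγ] using ((hasDerivAt_id' t).mul_const (y (n, b) - x (n, b))).const_add (x (n, b)))
      (fun l s => by simp only [baseFn, hb])
    rw [← hF.field hφ hψ ht fun n b hne l s => baseFn_update l _ (by
      rintro rfl
      exact hne (by rw [hxy b, sub_self])) b s] at h1
    have h2 : ∑ᶠ n : ℕ, ∑ b, (y (n, b) - x (n, b)) * TwoPrimary.pd (n, b) F (γ t) = 0 := by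
      refine finsum_eq_zero_of_forall_eq_zero fun n => Finset.sum_eq_zero fun b _ => ?_
      by_cases hn : n = 0
      · subst hn
        rw [hxy b, sub_self, zero_mul]
      · rw [h n hn b _ ht, mul_zero]
    rwa [h2] at h1
  have hγ0 : γ 0 = x := by funext i; simp [hγ]
  have hγ1 : γ 1 = y := by funext i; simp [hγ]
  have := hfin.isClosed.isOpen_compl.is_const_of_deriv_eq_zero hconn
    (fun t ht => (hd t ht).differentiableAt.differentiableWithinAt)
    (fun t ht => (hd t ht).deriv) ((hSd 0).2 (by rwa [hγ0])) ((hSd 1).2 (by rwa [hγ1]))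
  simpa only [hγ0, hγ1] using this

theorem up_up (a : Fin 2) : up (up a) = a := Fin.rev_rev a

theorem ev_invCubeP (hφ : DifferentiableOn ℂ φ slitPlane) (a b : Fin 2) {x : Jet}
    (hx : x ∈ domain φ) :
    (invCubeP a b).ev (pt φ ψ x) (fun l => noLeaf l x) = ((dU φ x)⁻¹ ^ 3) a b := by
  have hv := isPoint_pt (ψ := ψ) hφ hx
  simp only [invCubeP, ev_sum, ev_mul hv, ← rep_prop (ψ := ψ) hφ _ _ x hx, prop, up_up, pow_succ,
    pow_zero, one_mul, Matrix.mul_apply, Fin.sum_univ_two]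
  ring

/-- The solutions of the homogeneous equations that vanish to first order on the small phase
space are zero. -/
theorem eq_zero_of_eth11 (hφ : DifferentiableOn ℂ φ slitPlane)
    (hψ : DifferentiableOn ℂ ψ slitPlane) {H : Jet → ℂ} {p : Ex (ℂ × ℂ → ℂ)}
    (hH : Rep φ ψ baseFn H p) (hi : Indep φ H)
    (h11 : ∀ a b, ∀ x ∈ domain φ, eth11 φ a b H x = 0) (h0 : ∀ x ∈ smallPhase, H x = 0)
    (h1 : ∀ a, ∀ x ∈ smallPhase, eth φ 1 a H x = 0) : ∀ x ∈ domain φ, H x = 0 := by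
  -- The small phase space contains a point over each (v, u), so it determines functions of (v, u).
  have hbase : ∀ x ∈ domain φ, ∃ y ∈ smallPhase, ∀ b, x (0, b) = y (0, b) := fun x hx =>
    ⟨fun i => if i.1 = 0 then x i else if i = (1, 0) then 1 else 0,
      ⟨by simpa using hx.1, by simp, by simp, fun n hn a => by
        have e0 : n ≠ 0 := by omega
        have e1 : n ≠ 1 := by omega
        simp [e0, e1]⟩, by simp⟩
  -- The functions `J c` are first integrals of the equations.
  set J : Fin 2 → Jet → ℂ := fun c x => ∑ b, ((dU φ x)⁻¹ ^ 3) c b * eth φ 1 b H x with hJdef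
  have hJ : ∀ c, Rep φ ψ baseFn (J c)
      (plus (times (Ex.lift (invCubeP c 0)) (ethP 1 0 p))
        (times (Ex.lift (invCubeP c 1)) (ethP 1 1 p))) :=
    fun c x hx => by
      simp only [hJdef, Fin.sum_univ_two, ev, ev_lift _ fun l => noLeaf l x, ev_invCubeP hφ _ _ hx,
        ← hH.eth_base hφ hψ one_ne_zero _ x hx]
  have hJi : ∀ c, Indep φ (J c) := fun c n hn b x hx s => by
    simp only [hJdef, dU_update hφ hn b hx, hi.eth_one hφ _ n hn b x hx s]
  have hJ1 : ∀ c a, ∀ x ∈ domain φ, eth φ 1 a (J c) x = 0 := fun c a x hx => by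
    have hv := isPoint_pt (ψ := ψ) hφ hx
    have hz : ∀ d, (ethP 1 a (invCubeP c d)).ev (pt φ ψ x) (fun l => noLeaf l x)
        + 3 * ∑ b, ((dU φ x)⁻¹ ^ 3) c b * corr0 φ a b [up d] x = 0 := fun d => by
      have := ev_eq_zero (val := pt φ ψ x) (lv := fun l => noLeaf l x) (isZero_invCubeP a c d)
      simp only [ev_add, ev_smul hv, ev_sum, ev_mul hv, ev_invCubeP hφ _ _ hx,
        ← rep_corr0 hφ hψ _ _ _ x hx] at this
      exact_mod_cast this
    have hy : ∀ b, eth φ 1 a (eth φ 1 b H) x = 3 * ∑ d, corr0 φ a b [up d] x * eth φ 1 d H x :=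
      fun b => sub_eq_zero.1 (h11 a b x hx)
    have hl : ∀ b, (ethP 1 a (times (Ex.lift (invCubeP c b)) (ethP 1 b p))).ev (pt φ ψ x)
          (fun l => baseFn l x)
        = (ethP 1 a (invCubeP c b)).ev (pt φ ψ x) (fun l => noLeaf l x) * eth φ 1 b H x
          + ((dU φ x)⁻¹ ^ 3) c b * eth φ 1 a (eth φ 1 b H) x := fun b => by
      rw [(hH.eth_base hφ hψ one_ne_zero b).eth_base hφ hψ one_ne_zero a x hx,
        hH.eth_base hφ hψ one_ne_zero b x hx, ← ev_invCubeP (ψ := ψ) hφ c b hx]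
      simp only [ethP, ev_der hv _ fun l => noLeaf l x, dev, ev_lift _ fun l => noLeaf l x,
        dev_lift _ _ fun l => noLeaf l x]
    have hs : ∀ q r : Ex (ℂ × ℂ → ℂ), (ethP 1 a (plus q r)).ev (pt φ ψ x) (fun l => baseFn l x)
        = (ethP 1 a q).ev (pt φ ψ x) (fun l => baseFn l x)
          + (ethP 1 a r).ev (pt φ ψ x) fun l => baseFn l x := fun q r => by
      simp only [ethP, ev_der hv _ fun l => noLeaf l x, dev]
    rw [(hJ c).eth_base hφ hψ one_ne_zero a x hx, hs, hl, hl, hy, hy]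
    have hz0 := hz 0
    have hz1 := hz 1
    simp only [Fin.sum_univ_two] at hz0 hz1 ⊢
    -- By the product rule, the derivative of (∂U)⁻³ cancels the right side of the system for ð_1 H.
    linear_combination (eth φ 1 0 H x) * hz0 + (eth φ 1 1 H x) * hz1
  have hJ0 : ∀ c, ∀ x ∈ domain φ, J c x = 0 := fun c x hx => by
    obtain ⟨y, hy, hxy⟩ := hbase x hx
    have : ∀ n, n ≠ 0 → ∀ b, ∀ x ∈ domain φ, pd (n, b) (J c) x = 0 := fun n hn b x hx => by
      by_cases hn1 : n = 1
      · subst hn1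
        exact congrFun (eq_zero_of_dU_pow hx 2 (g := fun b => pd (1, b) (J c) x) fun a =>
          ((hJi c).eth_one_eq a hx).symm.trans (hJ1 c a x hx)) b
      · exact (hJi c).pd_eq_zero (by omega) b hx
    rw [(hJ c).eq_of_pd_eq_zero hφ hψ this hx (smallPhase_subset_domain hφ hy) hxy]
    simp [hJdef, h1 _ y hy]
  have hH1 : ∀ a, ∀ x ∈ domain φ, eth φ 1 a H x = 0 := fun a x hx => by
    -- The integrating factor is invertible, so J = 0 gives ð_1 H = 0.
    have hM : ((dU φ x)⁻¹ ^ 3).det ≠ 0 := by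
      rw [Matrix.det_pow, Matrix.det_nonsing_inv, Ring.inverse_eq_inv']
      exact pow_ne_zero _ (inv_ne_zero hx.2)
    exact congrFun (Matrix.eq_zero_of_mulVec_eq_zero (v := fun b => eth φ 1 b H x) hM
      (funext fun c => hJ0 c x hx)) a
  intro x hx
  obtain ⟨y, hy, hxy⟩ := hbase x hx
  rw [hH.eq_of_pd_eq_zero hφ hψ (fun n hn b x hx => ?_) hx (smallPhase_subset_domain hφ hy) hxy,
    h0 y hy]
  by_cases hn1 : n = 1
  · subst hn1
    exact congrFun (eq_zero_of_dU_pow hx 2 (g := fun b => pd (1, b) H x) fun a =>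
      (hi.eth_one_eq a hx).symm.trans (hH1 a x hx)) b
  · exact hi.pd_eq_zero (by omega) b hx

theorem eqOn_of_solves (hφ : DifferentiableOn ℂ φ slitPlane)
    (hψ : DifferentiableOn ℂ ψ slitPlane) (h : ∀ u ∈ slitPlane, genusOne φ ψ u = 0)
    {F : Jet → ℂ} (hF : Admissible φ F) (hs : Solves φ ψ F) (hv : VanishesOnSmall φ F) :
    Set.EqOn F (F20 φ + F21 φ ψ) (domain φ) := by
  obtain ⟨p, hp⟩ := hF.exists_rep (ψ := ψ) hφ
  have hT := rep_F2 hφ hψ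
  have hTs := solves_F2 hφ hψ h
  have hTv := vanishesOnSmall_F2 hφ hψ
  intro x hx
  refine sub_eq_zero.1 (eq_zero_of_eth11 hφ hψ (hp.diff hT)
    (eth_sub_eq_zero hφ hψ hp hT hs.1 hTs.1) (fun a b y hy => ?_) (fun y hy => ?_)
    (fun a y hy => ?_) x hx)
  · rw [eth11_sub hφ hψ hp hT a b hy, hs.2 a b y hy, hTs.2 a b y hy, sub_self]
  · rw [hv.1 y hy, hTv.1 y hy, sub_zero]
  · rw [eth_sub hφ hψ hp hT one_ne_zero a (smallPhase_subset_domain hφ hy),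
      ← d1_smallPhase hφ hv.1 a hy, ← d1_smallPhase hφ hTv.1 a hy, hv.2 a y hy, hTv.2 a y hy,
      sub_zero]

end TwoPrimary

open TwoPrimary in
theorem mainTheorem1 (φ ψ : ℂ → ℂ)
    (hφ : DifferentiableOn ℂ φ Complex.slitPlane)
    (hψ : DifferentiableOn ℂ ψ Complex.slitPlane) :
    (∀ x ∈ domain φ,
      eth11 φ 0 0 (R φ ψ 2 0) x - eth φ 2 0 (R11 φ ψ 0 0) x =
        2 / 15 * x (1, 1) ^ 3 * (4 * x (1, 0) ^ 2 + x (1, 1) ^ 2 * deriv φ (x (0, 1)))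
          * genusOne φ ψ (x (0, 1))) ∧
    ((∃ F : Jet → ℂ, Admissible φ F ∧ Solves φ ψ F) ↔
      ∀ u ∈ Complex.slitPlane, genusOne φ ψ u = 0) ∧
    ((∀ u ∈ Complex.slitPlane, genusOne φ ψ u = 0) →
      Admissible φ (F20 φ + F21 φ ψ) ∧ Solves φ ψ (F20 φ + F21 φ ψ) ∧
      VanishesOnSmall φ (F20 φ + F21 φ ψ) ∧
      ∀ F : Jet → ℂ, Admissible φ F → Solves φ ψ F → VanishesOnSmall φ F →
        Set.EqOn F (F20 φ + F21 φ ψ) (domain φ)) :=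
  ⟨fun _ hx => commutator_eq hφ hψ hx,
    ⟨fun ⟨_, hF, hs⟩ => genusOne_eq_zero hφ hψ hF hs,
      fun h => ⟨_, admissible_F2 hφ hψ, solves_F2 hφ hψ h⟩⟩,
    fun h => ⟨admissible_F2 hφ hψ, solves_F2 hφ hψ h, vanishesOnSmall_F2 hφ hψ,
      fun _ hF hs hv => eqOn_of_solves hφ hψ h hF hs hv⟩⟩
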